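/- Let $B=(B_t)_{t\ge 0}$ be a standard Brownian motion on a probability space $(\Omega,\mathcal F,\mathbb P)$, let $n$ be a finite number, and let $\lambda_1,\dots,\lambda_n$ be distinct real numbers with $\lambda_j>-\tfrac12$ for all $j$. Put $$a_{j}=\frac{\prod_{l=1}^n(\lambda_j+\lambda_l+1)}{\prod_{l\ne j}(\lambda_j-\lambda_l)},\qquad K_n(x)=\sum_{j=1}^n a_j x^{\lambda_j},\qquad k_n(t,s)=t^{-1}K_n(s/t)\ \text{ for } s\le t,\quad k_n(t,s)=0\ \text{ for } s>t,$$ $$\rho_n(x)=1-\int_1^x K_n(1/r)\,\frac{dr}{r}\quad(x\ge 1),\qquad \eta_n(t)=\mathbf 1_{\{t>0\}}\,e^{-t/2}\rho_n(e^t)\quad(t\in\mathbb R).$$ All stochastic integrals of deterministic functions are Wiener integrals. Let $T_n(B)$ be the (continuous version of the) Volterra transform $$T_n(B)_t=B_t-\int_0^t\Big(\int_0^s k_n(s,v)\,dB_v\Big)ds,\qquad t\ge 0,$$ let $\Theta_n(B)_u=e^{-u/2}\,T_n(B)_{e^u}$ for $u\in\mathbb R$, and let $W=(W_u)_{u\in\mathbb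 R}$ be the continuous process $$W_u=B_1+\int_1^{e^u}\frac{dB_s}{\sqrt s}\quad(u\ge 0),\qquad W_u=B_1-\int_{e^u}^1\frac{dB_s}{\sqrt s}\quad(u\le 0).$$ Then $T_n(B)$ and $W$ exist, $W$ is a Brownian motion indexed by $\mathbb R$ (a centered continuous Gaussian process with independent increments and $\mathbb E[(W_u-W_v)^2]=|u-v|$), and $\Theta_n(B)$ has the moving-average representation $$\Theta_n(B)_u=\int_{-\infty}^u\eta_n(u-v)\,dW_v\quad\text{almost surely, for every }u\in\mathbb R.$$ Moreover $\eta_n\in L^1(\mathbb R)\cap L^2(\mathbb R)$, and its Fourier transform is $$\hat\eta_n(\xi)=\int_{\mathbb R}e^{i\xi x}\eta_n(x)\,dx=\frac{1}{\tfrac12-i\xi}\prod_{j=1}^n\frac{\xi-ip_j}{\xi+ip_j},\qquad \xi\in\mathbb R,\qquad p_j=\lambda_j+\tfrac12 .$$ -/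

import Mathlib

open MeasureTheory ProbabilityTheory Set
open scoped NNReal ENNReal

noncomputable section

namespace MuntzTransform

/-! ### Wiener integrals of deterministic functions -/

/-- A deterministic step function `∑ i, c i • 1_(a i, b i]` on the line. -/
structure StepData where
  /-- number of intervals -/
  n : ℕ
  /-- heights -/
  c : Fin n → ℝ
  /-- left end points -/
  a : Fin n → ℝ
  /-- right end points -/
  b : Fin n → ℝ
  le : ∀ i, a i ≤ b i

/-- The step function itself. -/
def StepData.toFun (φ : StepData) (t : ℝ) : ℝ :=
  ∑ i, (Ioc (φ.a i) (φ.b i)).indicator (fun _ => φ.c i) t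

/-- The elementary integral `∑ i, c i * (X (b i) - X (a i))` of a step function. -/
def StepData.integral {Ω : Type*} (φ : StepData) (X : ℝ → Ω → ℝ) (ω : Ω) : ℝ :=
  ∑ i, φ.c i * (X (φ.b i) ω - X (φ.a i) ω)

/-- `Z = ∫ f dX` almost surely, in the sense of Wiener: `f` is square integrable, `Z` is a square
integrable random variable, and there are step functions that approximate `f` in `L²(ℝ)` and
whose elementary integrals simultaneously approximate `Z` in `L²(P)`.  When `X` is a Brownian
motion the elementary integral is an isometry, so `Z` is determined by `f` almost surely. -/
def IsWienerIntegral {Ω : Type*} [MeasurableSpace Ω]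
    (X : ℝ → Ω → ℝ) (P : Measure Ω) (f : ℝ → ℝ) (Z : Ω → ℝ) : Prop :=
  MemLp f 2 (volume : Measure ℝ) ∧ MemLp Z 2 P ∧
    ∀ ε : ℝ≥0∞, 0 < ε → ∃ φ : StepData,
      eLpNorm (fun t => f t - φ.toFun t) 2 (volume : Measure ℝ) < ε ∧
      eLpNorm (fun ω => Z ω - φ.integral X ω) 2 P < ε

/-- `Z = ∫_S f dX` almost surely. -/
def IsWienerIntegralOn {Ω : Type*} [MeasurableSpace Ω]
    (X : ℝ → Ω → ℝ) (P : Measure Ω) (S : Set ℝ) (f : ℝ → ℝ) (Z : Ω → ℝ) : Prop :=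
  IsWienerIntegral X P (S.indicator f) Z

/-- A process on the half-line, regarded as a process on the line that is constant, equal to its
initial value, at negative times.  It is used only to write integrals `∫_S f dB` with
`S ⊆ (0, ∞)`; the increments over negative times vanish and contribute nothing. -/
def onLine {Ω : Type*} (B : ℝ≥0 → Ω → ℝ) (s : ℝ) : Ω → ℝ :=
  B s.toNNReal

/-! ### Brownian motion indexed by the line -/

/-- A Brownian motion indexed by `ℝ`: a centered Gaussian process with almost surely continuous
paths and independent increments such that `E[(W_u - W_v)²] = |u - v|`.  (No normalisation of
`W_0` is required.) -/
structure IsBrownianOnLine {Ω : Type*} [MeasurableSpace Ω] (W : ℝ → Ω → ℝ) (P : Measure Ω) :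
    Prop where
  gaussian : IsGaussianProcess W P
  centered : ∀ u, ∫ ω, W u ω ∂P = 0
  indep : HasIndepIncrements W P
  sq_incr : ∀ u v, ∫ ω, (W u ω - W v ω) ^ 2 ∂P = |u - v|
  cont : ∀ᵐ ω ∂P, Continuous (fun u => W u ω)

/-- `W` is the continuous process on the line given by
`W_u = B_1 + ∫_1^{e^u} dB_s / √s` for `u ≥ 0` and `W_u = B_1 - ∫_{e^u}^1 dB_s / √s` for `u ≤ 0`. -/
structure IsLogTimeChange {Ω : Type*} [MeasurableSpace Ω] (B : ℝ≥0 → Ω → ℝ) (W : ℝ → Ω → ℝ)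
    (P : Measure Ω) : Prop where
  of_nonneg : ∀ u : ℝ, 0 ≤ u →
    IsWienerIntegralOn (onLine B) P (Ioc 1 (Real.exp u)) (fun s => 1 / Real.sqrt s)
      (fun ω => W u ω - B 1 ω)
  of_nonpos : ∀ u : ℝ, u ≤ 0 →
    IsWienerIntegralOn (onLine B) P (Ioc (Real.exp u) 1) (fun s => 1 / Real.sqrt s)
      (fun ω => B 1 ω - W u ω)
  cont : ∀ᵐ ω ∂P, Continuous (fun u => W u ω)

/-! ### Volterra transforms -/

/-- `X` is the Volterra transform of `B` with kernel `l`,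
`X_t = B_t - ∫_0^t (∫_0^s l(s, v) dB_v) ds` for all `t ≥ 0`.
Here `Y s` is a jointly measurable version of the inner Wiener integral and the outer integral is
a pathwise Lebesgue integral; since the identity holds for all `t` simultaneously, almost surely,
`X` is the version with continuous paths when `B` is continuous. -/
def IsVolterraTransform {Ω : Type*} [MeasurableSpace Ω] (l : ℝ → ℝ → ℝ)
    (B X : ℝ≥0 → Ω → ℝ) (P : Measure Ω) : Prop :=
  ∃ Y : ℝ → Ω → ℝ,
    AEStronglyMeasurable (Function.uncurry Y) ((volume.restrict (Ioi (0 : ℝ))).prod P) ∧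
    (∀ s : ℝ, 0 < s → IsWienerIntegralOn (onLine B) P (Ioc 0 s) (fun v => l s v) (Y s)) ∧
    ∀ᵐ ω ∂P, ∀ t : ℝ≥0,
      IntegrableOn (fun s => Y s ω) (Ioc 0 (t : ℝ)) ∧
      X t ω = B t ω - ∫ s in Ioc 0 (t : ℝ), Y s ω

/-! ### The Müntz kernels -/

/-- `a_j = ∏_l (λ_j + λ_l + 1) / ∏_{l ≠ j} (λ_j - λ_l)`. -/
def muntzCoeff {n : ℕ} (lam : Fin n → ℝ) (j : Fin n) : ℝ :=
  (∏ l, (lam j + lam l + 1)) / ∏ l ∈ Finset.univ.erase j, (lam j - lam l)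

/-- `K_n(x) = ∑_j a_j x ^ λ_j`. -/
def muntzK {n : ℕ} (lam : Fin n → ℝ) (x : ℝ) : ℝ :=
  ∑ j, muntzCoeff lam j * x ^ lam j

/-- The homogeneous kernel `k_n(t, s) = t⁻¹ K_n(s / t)` for `s ≤ t`, and `0` otherwise. -/
def muntzKernel {n : ℕ} (lam : Fin n → ℝ) (t s : ℝ) : ℝ :=
  if s ≤ t then t⁻¹ * muntzK lam (s / t) else 0

/-- `ρ_n(x) = 1 - ∫_1^x K_n(1 / r) dr / r`, for `x ≥ 1`. -/
def muntzRho {n : ℕ} (lam : Fin n → ℝ) (x : ℝ) : ℝ :=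
  1 - ∫ r in (1 : ℝ)..x, muntzK lam (1 / r) / r

/-- `η_n(t) = 1_{t > 0} e^{-t/2} ρ_n(e^t)`. -/
def muntzEta {n : ℕ} (lam : Fin n → ℝ) (t : ℝ) : ℝ :=
  if 0 < t then Real.exp (-t / 2) * muntzRho lam (Real.exp t) else 0

/-- The time-changed process `u ↦ e^{-u/2} X_{e^u}`, `u ∈ ℝ`. -/
def timeChange {Ω : Type*} (X : ℝ≥0 → Ω → ℝ) (u : ℝ) (ω : Ω) : ℝ :=
  Real.exp (-u / 2) * X (Real.exp u).toNNReal ω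

end MuntzTransform

end

noncomputable section

namespace MuntzTransform

open Filter Topology

/-! ### Square integrable functions -/

section L2

variable {α : Type*} [MeasurableSpace α] {μ : Measure α}

/-! Every random variable involved is a Wiener integral against `B`, so the probabilistic claims
reduce to identities between kernels in `L²(0,∞)`. The tool is `IsHalfLineIntegral.of_pairing`: `Z =
∫ f dB` as soon as `Z` has the right pairings with all `B_t` and the right second moment. It yields
the stochastic Fubini theorem `integral_fubini`.

Fubini and the substitution `s = v r` give `T_n(B)_t = ∫_0^t ρ_n(t/v) dB_v`. The map sending `g` to
`g(log x)/√x` is an isometry from `L²(ℝ)` to `L²(0,∞)` and carries `dW`-integrals to `dB`-integrals.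
Since `η_n(u - log x)/√x = e^{-u/2} ρ_n(e^u/x)` for `0 < x < e^u`, the moving average follows. The
increments of `W` have kernels `1/√x` on `(e^a, e^b]`; these are orthogonal for disjoint intervals
and have squared norm `b - a`, and Wiener integrals are jointly Gaussian, so `W` is a Brownian
motion. Existence of both processes comes from pathwise formulas obtained by integration by parts.

For the Fourier transform put `z = iξ` and `H(t) = e^{zt} e^{-t/2} ρ_n(e^t)`. Then `H' = (z - 1/2) H
- ∑ a_j e^{(z-p_j)t}`, with `H(0) = 1` and `H(∞) = 0`. Integrating over `(0,∞)` gives `(1/2 - z)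
η̂_n = 1 + ∑ a_j/(z - p_j)`. As `a_j = ∏ (p_j+p_l) / ∏_{l≠j} (p_j-p_l)`, the right side is the
partial fraction expansion of `∏ (z+p_l)/(z-p_l)`. -/

lemma eLpNorm_two_eq_ofReal {f : α → ℝ} (hf : MemLp f 2 μ) :
    eLpNorm f 2 μ = ENNReal.ofReal (Real.sqrt (∫ x, f x ^ 2 ∂μ)) := by
  rw [hf.eLpNorm_eq_integral_rpow_norm (by norm_num) (by norm_num), Real.sqrt_eq_rpow]
  simp

lemma integral_sq_eq_of_eLpNorm_eq {β : Type*} [MeasurableSpace β] {ν : Measure β}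
    {f : α → ℝ} {g : β → ℝ} (hf : MemLp f 2 μ) (hg : MemLp g 2 ν)
    (h : eLpNorm f 2 μ = eLpNorm g 2 ν) : ∫ x, f x ^ 2 ∂μ = ∫ x, g x ^ 2 ∂ν := by
  rw [eLpNorm_two_eq_ofReal hf, eLpNorm_two_eq_ofReal hg,
    ENNReal.ofReal_eq_ofReal_iff (Real.sqrt_nonneg _) (Real.sqrt_nonneg _)] at h
  exact (Real.sqrt_inj (by positivity) (by positivity)).1 h

lemma eLpNorm_eq_of_integral_sq_eq {β : Type*} [MeasurableSpace β] {ν : Measure β}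
    {f : α → ℝ} {g : β → ℝ} (hf : MemLp f 2 μ) (hg : MemLp g 2 ν)
    (h : ∫ x, f x ^ 2 ∂μ = ∫ x, g x ^ 2 ∂ν) : eLpNorm f 2 μ = eLpNorm g 2 ν := by
  rw [eLpNorm_two_eq_ofReal hf, eLpNorm_two_eq_ofReal hg, h]

lemma integral_sub_sq {f g : α → ℝ} (hf : MemLp f 2 μ) (hg : MemLp g 2 μ) :
    ∫ x, (f x - g x) ^ 2 ∂μ =
      ∫ x, f x ^ 2 ∂μ - 2 * ∫ x, f x * g x ∂μ + ∫ x, g x ^ 2 ∂μ := by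
  have h1 : Integrable (fun x => f x ^ 2) μ := hf.integrable_sq
  have h2 : Integrable (fun x => g x ^ 2) μ := hg.integrable_sq
  have h3 : Integrable (fun x => 2 * (f x * g x)) μ := (hf.integrable_mul hg).const_mul 2
  rw [← integral_const_mul, ← integral_sub h1 h3,
    ← integral_add (f := fun x => f x ^ 2 - 2 * (f x * g x)) (h1.sub h3) h2]
  congr with x
  ring

lemma integral_add_sq {f g : α → ℝ} (hf : MemLp f 2 μ) (hg : MemLp g 2 μ) :
    ∫ x, (f x + g x) ^ 2 ∂μ =
      ∫ x, f x ^ 2 ∂μ + 2 * ∫ x, f x * g x ∂μ + ∫ x, g x ^ 2 ∂μ := by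
  have h1 : Integrable (fun x => f x ^ 2) μ := hf.integrable_sq
  have h2 : Integrable (fun x => g x ^ 2) μ := hg.integrable_sq
  have h3 : Integrable (fun x => 2 * (f x * g x)) μ := (hf.integrable_mul hg).const_mul 2
  rw [← integral_const_mul, ← integral_add h1 h3,
    ← integral_add (f := fun x => f x ^ 2 + 2 * (f x * g x)) (h1.add h3) h2]
  congr with x
  ring

/-- Cauchy–Schwarz, as Hölder's inequality with exponents 2, 2 and 1. -/
lemma lintegral_enorm_mul_le {f g : α → ℝ} (hf : AEStronglyMeasurable f μ)
    (hg : AEStronglyMeasurable g μ) :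
    ∫⁻ x, ‖f x‖ₑ * ‖g x‖ₑ ∂μ ≤ eLpNorm f 2 μ * eLpNorm g 2 μ := by
  have := eLpNorm_smul_le_mul_eLpNorm (p := 2) (q := 2) (r := 1) hg hf
  rw [eLpNorm_one_eq_lintegral_enorm] at this
  simpa [enorm_mul] using this

/-! ### Integrals of families of square integrable functions -/

variable {β : Type*} [MeasurableSpace β] {ν : Measure β} [SFinite μ]

lemma lintegral_enorm_mul_enorm_le {F : β → α → ℝ}
    (hF : AEStronglyMeasurable (Function.uncurry F) (ν.prod μ)) {h : α → ℝ}
    (hh : AEStronglyMeasurable h μ) (hh' : eLpNorm h 2 μ ≠ ∞) :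
    ∫⁻ s, ∫⁻ x, ‖F s x‖ₑ * ‖h x‖ₑ ∂μ ∂ν ≤ (∫⁻ s, eLpNorm (F s) 2 μ ∂ν) * eLpNorm h 2 μ := by
  rw [← lintegral_mul_const' _ _ hh']
  refine lintegral_mono_ae ?_
  filter_upwards [hF.prodMk_left] with s hs using lintegral_enorm_mul_le hs hh

lemma integrable_uncurry_mul {F : β → α → ℝ}
    (hF : AEStronglyMeasurable (Function.uncurry F) (ν.prod μ))
    (hfin : ∫⁻ s, eLpNorm (F s) 2 μ ∂ν ≠ ∞) {h : α → ℝ} (hh : MemLp h 2 μ) :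
    Integrable (Function.uncurry fun s x => F s x * h x) (ν.prod μ) := by
  have hm : AEStronglyMeasurable (Function.uncurry fun s x => F s x * h x) (ν.prod μ) :=
    hF.mul hh.1.comp_snd
  refine ⟨hm, ?_⟩
  rw [HasFiniteIntegral, lintegral_prod _ hm.enorm]
  simp only [Function.uncurry, enorm_mul]
  exact (lintegral_enorm_mul_enorm_le hF hh.1 hh.2.ne).trans_lt
    (ENNReal.mul_lt_top hfin.lt_top hh.2)

variable [SFinite ν]

lemma integral_mul_integral_eq {F : β → α → ℝ}
    (hF : AEStronglyMeasurable (Function.uncurry F) (ν.prod μ))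
    (hfin : ∫⁻ s, eLpNorm (F s) 2 μ ∂ν ≠ ∞) {h : α → ℝ} (hh : MemLp h 2 μ) :
    ∫ x, (∫ s, F s x ∂ν) * h x ∂μ = ∫ s, ∫ x, F s x * h x ∂μ ∂ν := by
  rw [integral_integral_swap (integrable_uncurry_mul hF hfin hh)]
  simp_rw [integral_mul_const]

/-- Minkowski's integral inequality, in qualitative form. -/
lemma memLp_two_integral {F : β → α → ℝ}
    (hF : AEStronglyMeasurable (Function.uncurry F) (ν.prod μ))
    (hmem : ∀ᵐ s ∂ν, MemLp (F s) 2 μ)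
    (hfin : ∫⁻ s, eLpNorm (F s) 2 μ ∂ν ≠ ∞) : MemLp (fun x => ∫ s, F s x ∂ν) 2 μ := by
  refine ⟨hF.prod_swap.integral_prod_right', ?_⟩
  set A : α → ℝ≥0∞ := fun x => ∫⁻ s, ‖F s x‖ₑ ∂ν with hA
  have hAm : AEMeasurable A μ := hF.prod_swap.enorm.lintegral_prod_right'
  have hswap : ∀ {g : α → ℝ≥0∞}, AEMeasurable g μ →
      ∫⁻ x, A x * g x ∂μ = ∫⁻ s, ∫⁻ x, ‖F s x‖ₑ * g x ∂μ ∂ν := by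
    intro g hg
    rw [lintegral_lintegral_swap (hF.enorm.mul hg.comp_snd)]
    refine lintegral_congr_ae ?_
    filter_upwards [hF.prod_swap.prodMk_left] with x hx
    exact (lintegral_mul_const'' _ hx.enorm).symm
  -- Expand `∫ A²` as a double integral over pairs `(s, s')` and apply Cauchy–Schwarz to each pair.
  -- The two factors are swapped out one after the other, so finiteness of `∫ A²` is never
  -- presupposed.
  have key : ∫⁻ x, A x * A x ∂μ ≤ (∫⁻ s, eLpNorm (F s) 2 μ ∂ν) * ∫⁻ s, eLpNorm (F s) 2 μ ∂ν := by
    rw [hswap hAm, ← lintegral_const_mul' _ _ hfin]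
    refine lintegral_mono_ae ?_
    filter_upwards [hmem] with s hs
    simp_rw [mul_comm _ (A _)]
    rw [hswap hs.1.enorm]
    exact lintegral_enorm_mul_enorm_le hF hs.1 hs.2.ne
  rw [eLpNorm_lt_top_iff_lintegral_rpow_enorm_lt_top (by norm_num) (by norm_num)]
  refine lt_of_le_of_lt ?_ (key.trans_lt (ENNReal.mul_lt_top hfin.lt_top hfin.lt_top))
  refine lintegral_mono fun x => ?_
  have : ‖∫ s, F s x ∂ν‖ₑ ≤ A x := enorm_integral_le_lintegral_enorm _
  simpa [pow_two] using mul_le_mul' this this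

end L2

/-! ### Step functions -/

namespace StepData

/-- The sum of two step functions. -/
def add (φ ψ : StepData) : StepData where
  n := φ.n + ψ.n
  c := Fin.append φ.c ψ.c
  a := Fin.append φ.a ψ.a
  b := Fin.append φ.b ψ.b
  le := Fin.addCases (fun i => by simpa using φ.le i) (fun i => by simpa using ψ.le i)

/-- A multiple of a step function. -/
def smul (r : ℝ) (φ : StepData) : StepData where
  n := φ.n
  c i := r * φ.c i
  a := φ.a
  b := φ.b
  le := φ.le

variable {Ω : Type*} (X : ℝ → Ω → ℝ) (ω : Ω)

lemma add_toFun (φ ψ : StepData) (t : ℝ) : (φ.add ψ).toFun t = φ.toFun t + ψ.toFun t := by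
  refine (Fin.sum_univ_add (a := φ.n) (b := ψ.n) _).trans ?_
  simp [toFun, add]

lemma add_integral (φ ψ : StepData) :
    (φ.add ψ).integral X ω = φ.integral X ω + ψ.integral X ω := by
  refine (Fin.sum_univ_add (a := φ.n) (b := ψ.n) _).trans ?_
  simp [integral, add]

lemma smul_toFun (r : ℝ) (φ : StepData) (t : ℝ) : (φ.smul r).toFun t = r * φ.toFun t := by
  simp only [toFun, smul, Finset.mul_sum]
  refine Finset.sum_congr rfl fun i _ => ?_
  by_cases h : t ∈ Ioc (φ.a i) (φ.b i) <;> simp [h]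

lemma smul_integral (r : ℝ) (φ : StepData) : (φ.smul r).integral X ω = r * φ.integral X ω := by
  simp only [integral, smul, Finset.mul_sum, mul_assoc]
  rfl

lemma memLp_toFun (φ : StepData) : MemLp φ.toFun 2 (volume : Measure ℝ) := by
  have : φ.toFun = fun t => ∑ i, (Ioc (φ.a i) (φ.b i)).indicator (fun _ => φ.c i) t := rfl
  rw [this]
  refine memLp_finsetSum _ fun i _ => ?_
  exact memLp_indicator_const 2 measurableSet_Ioc _ (Or.inr (by simp))

end StepData

/-- Step functions are dense among continuous compactly supported functions. -/
lemma exists_stepData_of_continuous {g : ℝ → ℝ} (hg : Continuous g) (hc : HasCompactSupport g)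
    {ε : ℝ≥0∞} (hε : 0 < ε) :
    ∃ φ : StepData, eLpNorm (fun t => g t - φ.toFun t) 2 (volume : Measure ℝ) < ε := by
  obtain ⟨R, hR⟩ := hc.isCompact.isBounded.subset_closedBall 0
  obtain ⟨N, hN⟩ := exists_nat_gt R
  have hsupp : ∀ t, t ∉ Ioc (-N : ℝ) N → g t = 0 := by
    intro t ht
    by_contra h
    have := hR (subset_tsupport g h)
    rw [Metric.mem_closedBall, dist_zero_right, Real.norm_eq_abs, abs_le] at this
    exact ht ⟨by linarith, by linarith⟩
  obtain ⟨η, hη, hηε⟩ := ENNReal.exists_nnreal_pos_mul_lt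
    (a := volume (Ioc (-N : ℝ) N) ^ (1 / (2 : ℝ≥0∞).toReal)) (b := ε) (by simp) hε.ne'
  obtain ⟨δ, hδ, hδ'⟩ := Metric.uniformContinuous_iff.1 (hc.uniformContinuous_of_continuous hg) η
    (by exact_mod_cast hη)
  obtain ⟨m, hm⟩ := exists_nat_one_div_lt hδ
  set M : ℝ := m + 1 with hM
  have hM0 : 0 < M := by positivity
  -- Cells of length `1/M < δ` covering `(-N, N]`, with `g` sampled at right end points; the ceiling
  -- of `(t + N) M` then identifies the cell of `t`.
  let φ : StepData :=
    { n := 2 * N * (m + 1)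
      c := fun i => g (-N + (i + 1) / M)
      a := fun i => -N + i / M
      b := fun i => -N + (i + 1) / M
      le := fun i => by gcongr; simp }
  have hmem : ∀ (t : ℝ) (i : ℕ), t ∈ Ioc (-N + i / M : ℝ) (-N + (i + 1) / M) ↔
      ⌈(t + N) * M⌉ = i + 1 := by
    intro t i
    rw [Int.ceil_eq_iff, mem_Ioc]
    push_cast
    rw [add_sub_cancel_right]
    refine and_congr ?_ ?_
    · rw [← div_lt_iff₀ hM0]; constructor <;> intro h <;> linarith
    · rw [← le_div_iff₀ hM0]; constructor <;> intro h <;> linarith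
  have hφ : ∀ t, φ.toFun t = ∑ i : Fin (2 * N * (m + 1)),
      if ⌈(t + N) * M⌉ = (i : ℕ) + 1 then g (-N + ((i : ℕ) + 1) / M) else 0 := by
    intro t
    refine Finset.sum_congr rfl fun i _ => ?_
    simp only [φ, indicator_apply]
    exact if_congr (hmem t i) rfl rfl
  refine ⟨φ, lt_of_le_of_lt (eLpNorm_mono (g := (Ioc (-N : ℝ) N).indicator fun _ => (η : ℝ)) ?_)
    (lt_of_le_of_lt (eLpNorm_indicator_const_le _ _) (by simpa using hηε))⟩
  intro t
  by_cases ht : t ∈ Ioc (-N : ℝ) N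
  · have h0 : 0 < (t + N) * M := mul_pos (by linarith [ht.1]) hM0
    obtain ⟨k, hk⟩ : ∃ k : ℕ, ⌈(t + N) * M⌉ = k + 1 := by
      obtain ⟨k, hk⟩ := Int.eq_ofNat_of_zero_le (a := ⌈(t + N) * M⌉ - 1)
        (by have := Int.ceil_pos.2 h0; omega)
      exact ⟨k, by omega⟩
    have hk2 : k < 2 * N * (m + 1) := by
      have : ⌈(t + N) * M⌉ ≤ (2 * N * (m + 1) : ℕ) := by
        rw [Int.ceil_le]
        push_cast
        rw [← hM]
        have := ht.2
        gcongr
        linarith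
      omega
    have : φ.toFun t = g (-N + (k + 1) / M) := by
      rw [hφ, Finset.sum_eq_single ⟨k, hk2⟩]
      · simp [hk]
      · intro i _ hi
        rw [if_neg]
        intro h
        apply hi
        ext
        simp only
        omega
      · simp
    rw [this, indicator_of_mem ht]
    have hk3 := (hmem t k).2 hk
    have h4 : dist t (-N + (k + 1) / M) < δ := by
      rw [Real.dist_eq, abs_lt]
      have : (k + 1 : ℝ) / M = k / M + 1 / M := by ring
      constructor <;> linarith [hk3.1, hk3.2]
    simpa only [Real.dist_eq, Real.norm_eq_abs, NNReal.abs_eq] using (hδ' h4).le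
  · have : φ.toFun t = 0 := by
      rw [hφ]
      refine Finset.sum_eq_zero fun i _ => if_neg fun h => ht ?_
      have h2 := (hmem t i).2 h
      have hi : ((i : ℕ) + 1 : ℝ) ≤ 2 * N * M := by
        have := i.2
        rw [hM]
        exact_mod_cast this
      have h3 : ((i : ℕ) + 1 : ℝ) / M ≤ 2 * N := by rwa [div_le_iff₀ hM0]
      have h4 : (0 : ℝ) ≤ (i : ℕ) / M := by positivity
      exact ⟨by linarith [h2.1], by linarith [h2.2]⟩
    rw [this, hsupp t ht]
    simp [ht]

/-- Step functions are dense in `L²(ℝ)`. -/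
lemma exists_stepData_eLpNorm_sub_lt {f : ℝ → ℝ} (hf : MemLp f 2 (volume : Measure ℝ))
    {ε : ℝ≥0∞} (hε : 0 < ε) :
    ∃ φ : StepData, eLpNorm (fun t => f t - φ.toFun t) 2 (volume : Measure ℝ) < ε := by
  have hε2 : 0 < ε / 2 := ENNReal.half_pos hε.ne'
  obtain ⟨δ, hδ, hδε⟩ := exists_between hε2
  obtain ⟨g, hg, hfg, hgc, hgm⟩ :=
    hf.exists_hasCompactSupport_eLpNorm_sub_le (by norm_num) (ε := δ) hδ.ne'
  obtain ⟨φ, hφ⟩ := exists_stepData_of_continuous hgc hg hε2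
  refine ⟨φ, ?_⟩
  have : (fun t => f t - φ.toFun t) = (f - g) + fun t => g t - φ.toFun t := by
    ext t; simp
  rw [this]
  calc _ ≤ _ := eLpNorm_add_le (hf.sub hgm).1 (hgm.sub φ.memLp_toFun).1 (by norm_num)
    _ < ε / 2 + ε / 2 := ENNReal.add_lt_add (hfg.trans_lt hδε) hφ
    _ = ε := ENNReal.add_halves ε

/-! ### Linearity of the Wiener integral -/

section Linear

variable {Ω : Type*} [MeasurableSpace Ω] {P : Measure Ω} {X : ℝ → Ω → ℝ} {f g : ℝ → ℝ}
  {Y Z : Ω → ℝ}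

lemma IsWienerIntegral.congr (h : IsWienerIntegral X P f Y) (hf : f =ᵐ[volume] g)
    (hY : Y =ᵐ[P] Z) : IsWienerIntegral X P g Z := by
  refine ⟨h.1.ae_eq hf, h.2.1.ae_eq hY, fun ε hε => ?_⟩
  obtain ⟨φ, h1, h2⟩ := h.2.2 ε hε
  refine ⟨φ, ?_, ?_⟩
  · rwa [eLpNorm_congr_ae (g := fun t => f t - φ.toFun t)]
    filter_upwards [hf] with t ht
    rw [ht]
  · rwa [eLpNorm_congr_ae (g := fun ω => Y ω - φ.integral X ω)]
    filter_upwards [hY] with ω hω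
    rw [hω]

lemma IsWienerIntegral.const_mul (h : IsWienerIntegral X P f Y) (r : ℝ) :
    IsWienerIntegral X P (fun t => r * f t) (fun ω => r * Y ω) := by
  refine ⟨h.1.const_mul r, h.2.1.const_mul r, fun ε hε => ?_⟩
  obtain ⟨δ, hδ, hδε⟩ := ENNReal.exists_nnreal_pos_mul_lt (a := ‖r‖ₑ) (b := ε) (by simp) hε.ne'
  obtain ⟨φ, h1, h2⟩ := h.2.2 δ (by exact_mod_cast hδ)
  refine ⟨φ.smul r, ?_, ?_⟩
  · simp_rw [StepData.smul_toFun, ← mul_sub]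
    refine lt_of_eq_of_lt (eLpNorm_const_smul r (fun t => f t - φ.toFun t) 2 volume) ?_
    refine lt_of_le_of_lt ?_ hδε
    rw [mul_comm]
    gcongr
  · simp_rw [StepData.smul_integral, ← mul_sub]
    refine lt_of_eq_of_lt (eLpNorm_const_smul r (fun ω => Y ω - φ.integral X ω) 2 P) ?_
    refine lt_of_le_of_lt ?_ hδε
    rw [mul_comm]
    gcongr

lemma eLpNorm_add_lt_of_half {α : Type*} [MeasurableSpace α] {μ : Measure α} {u v : α → ℝ}
    {ε : ℝ≥0∞} (hu : eLpNorm u 2 μ < ε / 2) (hv : eLpNorm v 2 μ < ε / 2)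
    (hum : AEStronglyMeasurable u μ) (hvm : AEStronglyMeasurable v μ) :
    eLpNorm (fun x => u x + v x) 2 μ < ε :=
  calc _ ≤ _ := eLpNorm_add_le hum hvm (by norm_num)
    _ < ε / 2 + ε / 2 := ENNReal.add_lt_add hu hv
    _ = ε := ENNReal.add_halves ε

/-- `X` is square integrable at each time. -/
def IsL2Process (X : ℝ → Ω → ℝ) (P : Measure Ω) : Prop :=
  ∀ t, MemLp (X t) 2 P

lemma IsL2Process.integral (hX : IsL2Process X P) (φ : StepData) : MemLp (φ.integral X) 2 P := by
  have : φ.integral X = fun ω => ∑ i, φ.c i * (X (φ.b i) ω - X (φ.a i) ω) := rfl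
  rw [this]
  exact memLp_finsetSum _ fun i _ => ((hX _).sub (hX _)).const_mul _

lemma IsWienerIntegral.add (hX : IsL2Process X P) (hf : IsWienerIntegral X P f Y)
    (hg : IsWienerIntegral X P g Z) :
    IsWienerIntegral X P (fun t => f t + g t) (fun ω => Y ω + Z ω) := by
  refine ⟨hf.1.add hg.1, hf.2.1.add hg.2.1, fun ε hε => ?_⟩
  obtain ⟨φ, h1, h2⟩ := hf.2.2 (ε / 2) (ENNReal.half_pos hε.ne')
  obtain ⟨ψ, h3, h4⟩ := hg.2.2 (ε / 2) (ENNReal.half_pos hε.ne')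
  refine ⟨φ.add ψ, ?_, ?_⟩
  · simp_rw [StepData.add_toFun, add_sub_add_comm]
    exact eLpNorm_add_lt_of_half h1 h3 (hf.1.sub φ.memLp_toFun).1 (hg.1.sub ψ.memLp_toFun).1
  · simp_rw [StepData.add_integral, add_sub_add_comm]
    exact eLpNorm_add_lt_of_half h2 h4 (hf.2.1.sub (hX.integral φ)).1
      (hg.2.1.sub (hX.integral ψ)).1

end Linear

/-! ### Wiener integrals over the half-line with respect to a Brownian motion -/

/-- Lebesgue measure on the half-line `(0, ∞)`. -/
abbrev halfLine : Measure ℝ := volume.restrict (Ioi (0 : ℝ))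

lemma halfLine_Iic_lt_top (t : ℝ) : halfLine (Iic t) < ∞ := by
  rw [Measure.restrict_apply measurableSet_Iic, inter_comm, Ioi_inter_Iic]
  exact measure_Ioc_lt_top

lemma restrict_halfLine_Iic (t : ℝ) : halfLine.restrict (Iic t) = volume.restrict (Ioc 0 t) := by
  rw [Measure.restrict_restrict measurableSet_Iic, inter_comm, Ioi_inter_Iic]

lemma integrableOn_Iic_halfLine {f : ℝ → ℝ} (hf : MemLp f 2 halfLine) (t : ℝ) :
    IntegrableOn f (Iic t) halfLine := by
  have : IsFiniteMeasure (halfLine.restrict (Iic t)) :=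
    ⟨by simpa using halfLine_Iic_lt_top t⟩
  exact (hf.mono_measure Measure.restrict_le_self).integrable (by norm_num)

lemma setIntegral_indicator_Iic_halfLine (s t : ℝ) :
    ∫ x in Iic s, (Iic t).indicator (fun _ => (1 : ℝ)) x ∂halfLine =
      min s.toNNReal t.toNNReal := by
  rw [setIntegral_indicator measurableSet_Iic, setIntegral_const, Iic_inter_Iic, Measure.real,
    Measure.restrict_apply measurableSet_Iic, inter_comm, Ioi_inter_Iic, Real.volume_Ioc,
    sub_zero, ENNReal.toReal_ofReal', smul_eq_mul, mul_one, NNReal.coe_min, Real.coe_toNNReal',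
    Real.coe_toNNReal', max_min_distrib_right]

lemma StepData.memLp_toFun_halfLine (φ : StepData) : MemLp φ.toFun 2 halfLine :=
  φ.memLp_toFun.mono_measure Measure.restrict_le_self

/-- Triangle inequality in two different spaces, linked by approximants of equal norm. Used in both
directions to extend the isometry from step functions to their limits. -/
lemma eLpNorm_le_add_of_approx {α β : Type*} [MeasurableSpace α] [MeasurableSpace β]
    {μ : Measure α} {ν : Measure β} {u u' : α → ℝ} {v v' : β → ℝ} {ε : ℝ≥0∞}
    (hu : MemLp u 2 μ) (hu' : MemLp u' 2 μ) (hv : MemLp v 2 ν) (hv' : MemLp v' 2 ν)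
    (he : eLpNorm u' 2 μ = eLpNorm v' 2 ν) (h1 : eLpNorm (fun x => u x - u' x) 2 μ < ε / 2)
    (h2 : eLpNorm (fun x => v x - v' x) 2 ν < ε / 2) : eLpNorm u 2 μ ≤ eLpNorm v 2 ν + ε :=
  calc eLpNorm u 2 μ = eLpNorm ((u - u') + u') 2 μ := by simp
    _ ≤ ε / 2 + eLpNorm u' 2 μ :=
      (eLpNorm_add_le (hu.sub hu').1 hu'.1 (by norm_num)).trans (add_le_add_left h1.le _)
    _ = ε / 2 + eLpNorm (v - (v - v')) 2 ν := by simp [he]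
    _ ≤ ε / 2 + (eLpNorm v 2 ν + ε / 2) :=
      add_le_add_right ((eLpNorm_sub_le hv.1 (hv.sub hv').1 (by norm_num)).trans
        (add_le_add_right h2.le _)) _
    _ = eLpNorm v 2 ν + ε := by rw [add_left_comm, ENNReal.add_halves]

section Pairing

variable {Ω : Type*} [MeasurableSpace Ω] {P : Measure Ω} {B : ℝ≥0 → Ω → ℝ} {f g : ℝ → ℝ}
  {Y Z : Ω → ℝ}

lemma memLp_onLine (hB : IsPreBrownianReal B P) : IsL2Process (onLine B) P := fun _ =>
  (hB.isGaussianProcess.hasGaussianLaw_eval _).memLp_two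

lemma onLine_ae_eq_zero (hB : IsPreBrownianReal B P) {t : ℝ} (ht : t ≤ 0) :
    onLine B t =ᵐ[P] 0 := by
  rw [onLine, Real.toNNReal_of_nonpos ht]
  exact hB.eval_zero_ae_eq_zero

lemma integral_onLine_mul_onLine (hB : IsPreBrownianReal B P) (s t : ℝ) :
    ∫ ω, onLine B s ω * onLine B t ω ∂P = min s.toNNReal t.toNNReal := by
  have := hB.isGaussianProcess.isProbabilityMeasure
  have h := hB.covariance_eval s.toNNReal t.toNNReal
  rw [covariance_eq_sub (X := B _) (Y := B _) (memLp_onLine hB s) (memLp_onLine hB t),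
    hB.integral_eval, zero_mul, sub_zero] at h
  exact h

/-- Pairing an elementary integral with a random variable whose pairings with the Brownian
motion are known. -/
lemma integral_mul_stepIntegral (hB : IsPreBrownianReal B P) (hZ : MemLp Z 2 P)
    (hf : MemLp f 2 halfLine)
    (h : ∀ t, 0 < t → ∫ ω, Z ω * onLine B t ω ∂P = ∫ x in Iic t, f x ∂halfLine) (φ : StepData) :
    ∫ ω, Z ω * φ.integral (onLine B) ω ∂P = ∫ x, f x * φ.toFun x ∂halfLine := by
  -- Step functions may have nonpositive end points; there both sides vanish because `B_0 = 0`
  -- almost surely.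
  have h' : ∀ t, ∫ ω, Z ω * onLine B t ω ∂P = ∫ x in Iic t, f x ∂halfLine := by
    intro t
    rcases lt_or_ge 0 t with ht | ht
    · exact h t ht
    · rw [restrict_halfLine_Iic, Ioc_eq_empty (not_lt.2 ht), Measure.restrict_empty,
        integral_zero_measure]
      refine integral_eq_zero_of_ae ?_
      filter_upwards [onLine_ae_eq_zero hB ht] with ω hω
      simp [hω]
  have hint : ∀ t, Integrable (fun ω => Z ω * onLine B t ω) P := fun t =>
    hZ.integrable_mul (memLp_onLine hB t)
  have h1 : ∀ ω, Z ω * φ.integral (onLine B) ω =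
      ∑ i, φ.c i * (Z ω * onLine B (φ.b i) ω - Z ω * onLine B (φ.a i) ω) := by
    intro ω
    rw [StepData.integral, Finset.mul_sum]
    refine Finset.sum_congr rfl fun i _ => by ring
  have h2 : ∀ x, f x * φ.toFun x =
      ∑ i, φ.c i * (Ioc (φ.a i) (φ.b i)).indicator f x := by
    intro x
    rw [StepData.toFun, Finset.mul_sum]
    refine Finset.sum_congr rfl fun i _ => ?_
    by_cases hx : x ∈ Ioc (φ.a i) (φ.b i) <;> simp [hx, mul_comm]
  have hIoc : ∀ i, IntegrableOn f (Ioc (φ.a i) (φ.b i)) halfLine := fun i =>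
    (integrableOn_Iic_halfLine hf _).mono_set Ioc_subset_Iic_self
  simp_rw [h1, h2]
  rw [integral_finsetSum _ fun i _ => (by exact ((hint _).sub (hint _)).const_mul _),
    integral_finsetSum _ fun i _ =>
      ((integrable_indicator_iff measurableSet_Ioc).2 (hIoc i)).const_mul _]
  refine Finset.sum_congr rfl fun i _ => ?_
  rw [integral_const_mul, integral_const_mul, integral_sub (hint _) (hint _), h', h',
    integral_indicator measurableSet_Ioc, ← Iic_sdiff_Iic,
    setIntegral_sdiff measurableSet_Iic (integrableOn_Iic_halfLine hf _)
      (Iic_subset_Iic.2 (φ.le i))]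

/-- The pairing lemma is used twice: with `Z = B_t` it computes the pairings of the elementary
integral with `B_t`, and these are the input for `Z` equal to the elementary integral itself. -/
lemma integral_stepIntegral_sq (hB : IsPreBrownianReal B P) (φ : StepData) :
    ∫ ω, φ.integral (onLine B) ω ^ 2 ∂P = ∫ x, φ.toFun x ^ 2 ∂halfLine := by
  simp_rw [pow_two]
  refine integral_mul_stepIntegral hB ((memLp_onLine hB).integral φ) φ.memLp_toFun_halfLine ?_ φ
  intro t ht
  have hi : MemLp ((Iic t).indicator fun _ => (1 : ℝ)) 2 halfLine :=
    memLp_indicator_const 2 measurableSet_Iic _ (Or.inr (halfLine_Iic_lt_top t).ne)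
  have := integral_mul_stepIntegral hB (memLp_onLine hB t) hi ?_ φ
  · simp_rw [mul_comm _ (onLine B t _)]
    rw [this, ← integral_indicator measurableSet_Iic]
    congr with x
    by_cases hx : x ∈ Iic t <;> simp [hx]
  · intro s _
    rw [integral_onLine_mul_onLine hB, setIntegral_indicator_Iic_halfLine, min_comm]

lemma eLpNorm_stepIntegral (hB : IsPreBrownianReal B P) (φ : StepData) :
    eLpNorm (φ.integral (onLine B)) 2 P = eLpNorm φ.toFun 2 halfLine :=
  eLpNorm_eq_of_integral_sq_eq ((memLp_onLine hB).integral φ) φ.memLp_toFun_halfLine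
    (integral_stepIntegral_sq hB φ)

/-- `Z = ∫_0^∞ f dB` almost surely. -/
abbrev IsHalfLineIntegral (B : ℝ≥0 → Ω → ℝ) (P : Measure Ω) (f : ℝ → ℝ) (Z : Ω → ℝ) : Prop :=
  IsWienerIntegralOn (onLine B) P (Ioi 0) f Z

namespace IsHalfLineIntegral

lemma memLp (h : IsHalfLineIntegral B P f Z) : MemLp f 2 halfLine :=
  (memLp_indicator_iff_restrict measurableSet_Ioi).1 h.1

lemma memLp_right (h : IsHalfLineIntegral B P f Z) : MemLp Z 2 P := h.2.1

/-- A Wiener integral is characterized by its pairings with the Brownian motion and its second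
moment. -/
lemma of_pairing (hB : IsPreBrownianReal B P) (hf : MemLp f 2 halfLine) (hZ : MemLp Z 2 P)
    (h : ∀ t, 0 < t → ∫ ω, Z ω * onLine B t ω ∂P = ∫ x in Iic t, f x ∂halfLine)
    (hsq : ∫ ω, Z ω ^ 2 ∂P = ∫ x, f x ^ 2 ∂halfLine) : IsHalfLineIntegral B P f Z := by
  have hf' : MemLp ((Ioi (0 : ℝ)).indicator f) 2 volume :=
    (memLp_indicator_iff_restrict measurableSet_Ioi).2 hf
  refine ⟨hf', hZ, fun ε hε => ?_⟩
  obtain ⟨φ, hφ⟩ := exists_stepData_eLpNorm_sub_lt hf' hε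
  -- Any `φ` close to `f` serves: after expanding the square, all three terms for `Z - ∫ φ dB` agree
  -- with those for `f - φ`, so the two errors are equal.
  refine ⟨φ, hφ, lt_of_le_of_lt ?_ hφ⟩
  have hφi := (memLp_onLine hB).integral φ
  calc eLpNorm (fun ω => Z ω - φ.integral (onLine B) ω) 2 P
      = eLpNorm (fun x => f x - φ.toFun x) 2 halfLine := by
        refine eLpNorm_eq_of_integral_sq_eq (hZ.sub hφi) (hf.sub φ.memLp_toFun_halfLine) ?_
        rw [integral_sub_sq hZ hφi, integral_sub_sq hf φ.memLp_toFun_halfLine, hsq,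
          integral_stepIntegral_sq hB, integral_mul_stepIntegral hB hZ hf h]
    _ = eLpNorm (fun x => (Ioi (0 : ℝ)).indicator f x - φ.toFun x) 2 halfLine := by
        refine eLpNorm_congr_ae ?_
        filter_upwards [ae_restrict_mem measurableSet_Ioi] with x hx
        rw [indicator_of_mem hx]
    _ ≤ _ := eLpNorm_mono_measure _ Measure.restrict_le_self

lemma approx (h : IsHalfLineIntegral B P f Z) {ε : ℝ≥0∞}
    (hε : 0 < ε) : ∃ φ : StepData, eLpNorm (fun t => f t - φ.toFun t) 2 halfLine < ε ∧
      eLpNorm (fun ω => Z ω - φ.integral (onLine B) ω) 2 P < ε := by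
  obtain ⟨φ, h1, h2⟩ := h.2.2 ε hε
  refine ⟨φ, lt_of_le_of_lt ?_ h1, h2⟩
  refine le_trans (le_of_eq (eLpNorm_congr_ae ?_))
    (eLpNorm_mono_measure _ (Measure.restrict_le_self (s := Ioi 0)))
  filter_upwards [ae_restrict_mem measurableSet_Ioi] with x hx
  rw [indicator_of_mem hx]

lemma eLpNorm_eq (hB : IsPreBrownianReal B P) (h : IsHalfLineIntegral B P f Z) :
    eLpNorm Z 2 P = eLpNorm f 2 halfLine := by
  refine le_antisymm ?_ ?_ <;> refine ENNReal.le_of_forall_pos_le_add fun ε hε _ => ?_ <;>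
    obtain ⟨φ, h1, h2⟩ := h.approx (ε := ε / 2) (by simpa using hε.ne')
  · exact eLpNorm_le_add_of_approx h.memLp_right ((memLp_onLine hB).integral φ) h.memLp φ.memLp_toFun_halfLine
      (eLpNorm_stepIntegral hB φ) h2 h1
  · exact eLpNorm_le_add_of_approx h.memLp φ.memLp_toFun_halfLine h.memLp_right ((memLp_onLine hB).integral φ)
      (eLpNorm_stepIntegral hB φ).symm h1 h2

lemma integral_sq (hB : IsPreBrownianReal B P) (h : IsHalfLineIntegral B P f Z) :
    ∫ ω, Z ω ^ 2 ∂P = ∫ x, f x ^ 2 ∂halfLine :=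
  integral_sq_eq_of_eLpNorm_eq h.memLp_right h.memLp (h.eLpNorm_eq hB)

lemma congr (h : IsHalfLineIntegral B P f Y) (hf : ∀ x, 0 < x → f x = g x)
    (hY : Y =ᵐ[P] Z) : IsHalfLineIntegral B P g Z := by
  refine IsWienerIntegral.congr h (Eventually.of_forall fun x => ?_) hY
  by_cases hx : x ∈ Ioi (0 : ℝ)
  · simp only [indicator_of_mem hx, hf x hx]
  · simp only [indicator_of_notMem hx]

lemma add (hB : IsPreBrownianReal B P) (hf : IsHalfLineIntegral B P f Y)
    (hg : IsHalfLineIntegral B P g Z) :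
    IsHalfLineIntegral B P (fun t => f t + g t) (fun ω => Y ω + Z ω) := by
  have := IsWienerIntegral.add (memLp_onLine hB) hf hg
  simpa only [IsHalfLineIntegral, IsWienerIntegralOn, indicator_add] using this

lemma const_mul (hf : IsHalfLineIntegral B P f Y) (r : ℝ) :
    IsHalfLineIntegral B P (fun t => r * f t) (fun ω => r * Y ω) := by
  have := IsWienerIntegral.const_mul hf r
  simpa only [IsHalfLineIntegral, IsWienerIntegralOn, ← indicator_const_mul] using this

lemma sub (hB : IsPreBrownianReal B P) (hf : IsHalfLineIntegral B P f Y)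
    (hg : IsHalfLineIntegral B P g Z) :
    IsHalfLineIntegral B P (fun t => f t - g t) (fun ω => Y ω - Z ω) := by
  simpa [sub_eq_add_neg] using hf.add hB (hg.const_mul (-1))

lemma zero : IsHalfLineIntegral B P (fun _ => 0) (fun _ => 0) := by
  refine ⟨by simp, by simp, fun ε hε => ⟨⟨0, 0, 0, 0, fun i => i.elim0⟩, ?_, ?_⟩⟩
  · simpa [StepData.toFun] using hε
  · simpa [StepData.integral] using hε

lemma sum (hB : IsPreBrownianReal B P) {ι : Type*} (s : Finset ι) {F : ι → ℝ → ℝ}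
    {U : ι → Ω → ℝ} (h : ∀ i ∈ s, IsHalfLineIntegral B P (F i) (U i)) :
    IsHalfLineIntegral B P (fun t => ∑ i ∈ s, F i t) (fun ω => ∑ i ∈ s, U i ω) := by
  classical
  induction s using Finset.induction_on with
  | empty => simpa using zero
  | insert i s hi ih =>
    simp_rw [Finset.sum_insert hi]
    exact (h i (Finset.mem_insert_self i s)).add hB
      (ih fun j hj => h j (Finset.mem_insert_of_mem hj))

/-- Itô isometry. -/
lemma integral_mul (hB : IsPreBrownianReal B P) (hf : IsHalfLineIntegral B P f Y)
    (hg : IsHalfLineIntegral B P g Z) :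
    ∫ ω, Y ω * Z ω ∂P = ∫ x, f x * g x ∂halfLine := by
  -- Polarization of the isometry for second moments.
  have h := (hf.add hB hg).integral_sq hB
  rw [integral_add_sq hf.memLp_right hg.memLp_right, integral_add_sq hf.memLp hg.memLp,
    hf.integral_sq hB, hg.integral_sq hB] at h
  linarith

lemma brownian (hB : IsPreBrownianReal B P) (t : ℝ) :
    IsHalfLineIntegral B P ((Iic t).indicator fun _ => 1) (onLine B t) := by
  refine of_pairing hB
    (memLp_indicator_const 2 measurableSet_Iic _ (Or.inr (halfLine_Iic_lt_top t).ne))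
    (memLp_onLine hB t) (fun s _ => ?_) ?_
  · rw [integral_onLine_mul_onLine hB, setIntegral_indicator_Iic_halfLine, min_comm]
  · simp_rw [pow_two]
    rw [integral_onLine_mul_onLine hB]
    simp_rw [← indicator_mul, mul_one]
    rw [integral_indicator measurableSet_Iic, restrict_halfLine_Iic]
    simp

/-- Stochastic Fubini theorem. -/
lemma integral_fubini (hB : IsPreBrownianReal B P) {β : Type*} [MeasurableSpace β]
    {ν : Measure β} [SFinite ν] {F : β → ℝ → ℝ} {U : β → Ω → ℝ}
    (h : ∀ᵐ s ∂ν, IsHalfLineIntegral B P (F s) (U s))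
    (hF : AEStronglyMeasurable (Function.uncurry F) (ν.prod halfLine))
    (hU : AEStronglyMeasurable (Function.uncurry U) (ν.prod P))
    (hfin : ∫⁻ s, eLpNorm (F s) 2 halfLine ∂ν ≠ ∞) :
    IsHalfLineIntegral B P (fun x => ∫ s, F s x ∂ν) (fun ω => ∫ s, U s ω ∂ν) := by
  have := hB.isGaussianProcess.isProbabilityMeasure
  have hfinU : ∫⁻ s, eLpNorm (U s) 2 P ∂ν ≠ ∞ := by
    rwa [lintegral_congr_ae (g := fun s => eLpNorm (F s) 2 halfLine)]
    filter_upwards [h] with s hs using hs.eLpNorm_eq hB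
  have hG := memLp_two_integral hF (h.mono fun s hs => hs.memLp) hfin
  have hZ := memLp_two_integral hU (h.mono fun s hs => hs.memLp_right) hfinU
  -- Used twice: with `B_t` for the pairings, and with each `U s` to obtain the second moment of the
  -- integral.
  have pair : ∀ {g : ℝ → ℝ} {Y : Ω → ℝ}, IsHalfLineIntegral B P g Y →
      ∫ ω, (∫ s, U s ω ∂ν) * Y ω ∂P = ∫ x, (∫ s, F s x ∂ν) * g x ∂halfLine := by
    intro g Y hg
    rw [integral_mul_integral_eq hU hfinU hg.memLp_right, integral_mul_integral_eq hF hfin hg.memLp]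
    refine integral_congr_ae ?_
    filter_upwards [h] with s hs using hs.integral_mul hB hg
  refine of_pairing hB hG hZ (fun t _ => ?_) ?_
  · rw [pair (brownian hB t), ← integral_indicator measurableSet_Iic]
    congr with x
    by_cases hx : x ∈ Iic t <;> simp [hx]
  · simp_rw [pow_two]
    rw [integral_mul_integral_eq hU hfinU hZ, integral_mul_integral_eq hF hfin hG]
    refine integral_congr_ae ?_
    filter_upwards [h] with s hs
    simp_rw [mul_comm (U s _), mul_comm (F s _)]
    exact pair hs

end IsHalfLineIntegral

end Pairing

/-! ### Wiener integrals are Gaussian -/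

section Gaussian

variable {Ω : Type*} [MeasurableSpace Ω] {P : Measure Ω} {B : ℝ≥0 → Ω → ℝ} {f : ℝ → ℝ}
  {Z : Ω → ℝ}

/-- An elementary integral is a continuous linear functional of finitely many values of `B`. -/
lemma hasGaussianLaw_stepIntegral (hB : IsPreBrownianReal B P) (φ : StepData) :
    HasGaussianLaw (φ.integral (onLine B)) P := by
  have : IsGaussianProcess (fun φ : StepData => φ.integral (onLine B)) P := by
    classical
    refine hB.isGaussianProcess.of_isGaussianProcess fun φ =>
      ⟨Finset.univ.image (fun i => (φ.a i).toNNReal) ∪ Finset.univ.image fun i => (φ.b i).toNNReal,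
        { toFun := fun x => ∑ i, φ.c i * (x ⟨(φ.b i).toNNReal, by simp⟩ -
            x ⟨(φ.a i).toNNReal, by simp⟩)
          map_add' := fun x y => by
            simp only [Pi.add_apply, ← Finset.sum_add_distrib]
            exact Finset.sum_congr rfl fun i _ => by ring
          map_smul' := fun r x => by
            simp only [Pi.smul_apply, smul_eq_mul, RingHom.id_apply, Finset.mul_sum]
            exact Finset.sum_congr rfl fun i _ => by ring
          cont := by fun_prop }, fun ω => rfl⟩
  exact this.hasGaussianLaw_eval φ

lemma integral_stepIntegral (hB : IsPreBrownianReal B P) (φ : StepData) :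
    ∫ ω, φ.integral (onLine B) ω ∂P = 0 := by
  have hi : ∀ t, Integrable (onLine B t) P := fun t => hB.integrable_eval _
  simp only [StepData.integral]
  rw [integral_finsetSum _ fun i _ => (by exact ((hi _).sub (hi _)).const_mul _)]
  refine Finset.sum_eq_zero fun i _ => ?_
  rw [integral_const_mul, integral_sub (hi _) (hi _)]
  simp only [onLine, hB.integral_eval, sub_self, mul_zero]

lemma charFun_stepIntegral (hB : IsPreBrownianReal B P) (φ : StepData) (t : ℝ) :
    charFun (P.map (φ.integral (onLine B))) t =
      Complex.exp (-((∫ ω, φ.integral (onLine B) ω ^ 2 ∂P : ℝ) : ℂ) * t ^ 2 / 2) := by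
  have := hB.isGaussianProcess.isProbabilityMeasure
  rw [(hasGaussianLaw_stepIntegral hB φ).map_eq_gaussianReal, charFun_gaussianReal,
    integral_stepIntegral hB, Real.coe_toNNReal _ (variance_nonneg _ _),
    variance_eq_sub ((memLp_onLine hB).integral φ), integral_stepIntegral hB]
  congr 1
  simp only [Pi.pow_apply]
  push_cast
  ring

/-- A Wiener integral is a centered Gaussian variable. -/
lemma IsHalfLineIntegral.map_eq_gaussianReal (hB : IsPreBrownianReal B P)
    (h : IsHalfLineIntegral B P f Z) :
    P.map Z = gaussianReal 0 (∫ x, f x ^ 2 ∂halfLine).toNNReal := by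
  have := hB.isGaussianProcess.isProbabilityMeasure
  have hpos : ∀ n : ℕ, (0 : ℝ≥0∞) < (n : ℝ≥0∞)⁻¹ := fun n => by simp
  choose φ _ hφ using fun n : ℕ => h.approx (hpos n)
  have hm := fun n => (memLp_onLine hB).integral (φ n)
  have hlim : Tendsto (fun n => eLpNorm ((φ n).integral (onLine B) - Z) 2 P) atTop (𝓝 0) := by
    refine tendsto_of_tendsto_of_tendsto_of_le_of_le tendsto_const_nhds
      ENNReal.tendsto_inv_nat_nhds_zero (fun _ => zero_le) fun n => ?_
    rw [eLpNorm_sub_comm]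
    exact (hφ n).le
  have hsq : Tendsto (fun n => ∫ ω, (φ n).integral (onLine B) ω ^ 2 ∂P) atTop
      (𝓝 (∫ ω, Z ω ^ 2 ∂P)) := by
    have h1 := ((Lp.tendsto_Lp_iff_tendsto_eLpNorm'' _ hm Z h.memLp_right).2 hlim).norm.pow 2
    have h2 : ∀ {u : Ω → ℝ} (hu : MemLp u 2 P), ‖hu.toLp u‖ ^ 2 = ∫ ω, u ω ^ 2 ∂P := by
      intro u hu
      rw [Lp.norm_toLp, eLpNorm_two_eq_ofReal hu, ENNReal.toReal_ofReal (Real.sqrt_nonneg _),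
        Real.sq_sqrt (integral_nonneg fun _ => sq_nonneg _)]
    simpa only [h2] using h1
  -- `L²` convergence implies convergence in law, hence of characteristic functions. Those of the
  -- approximants depend on the second moment only, and second moments converge, so the limit is
  -- identified.
  have hdist := (tendstoInMeasure_of_tendsto_eLpNorm (by norm_num) (fun n => (hm n).1)
    h.memLp_right.1 hlim).tendstoInDistribution fun n => (hm n).1.aemeasurable
  have hchar := ProbabilityMeasure.tendsto_iff_tendsto_charFun.1 hdist.tendsto
  have := Measure.isProbabilityMeasure_map (μ := P) h.memLp_right.1.aemeasurable
  refine Measure.ext_of_charFun ?_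
  ext t
  refine tendsto_nhds_unique (hchar t) ?_
  rw [charFun_gaussianReal, ← h.integral_sq hB,
    Real.coe_toNNReal _ (integral_nonneg fun _ => sq_nonneg _)]
  simp only [ProbabilityMeasure.coe_mk, charFun_stepIntegral hB]
  have : Continuous fun v : ℝ => Complex.exp (-(v : ℂ) * t ^ 2 / 2) := by fun_prop
  convert (this.tendsto _).comp hsq using 3
  · rfl
  · push_cast
    ring

lemma IsHalfLineIntegral.integral_eq_zero (hB : IsPreBrownianReal B P)
    (h : IsHalfLineIntegral B P f Z) : ∫ ω, Z ω ∂P = 0 := by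
  have := integral_map (f := fun x : ℝ => x) h.memLp_right.1.aemeasurable
    aestronglyMeasurable_id
  rw [← this, h.map_eq_gaussianReal hB, integral_id_gaussianReal]

/-- Wiener integrals are jointly Gaussian. -/
lemma isGaussianProcess_of_isHalfLineIntegral (hB : IsPreBrownianReal B P) {T : Type*}
    {F : T → ℝ → ℝ} {U : T → Ω → ℝ} (h : ∀ t, IsHalfLineIntegral B P (F t) (U t)) :
    IsGaussianProcess U P where
  hasGaussianLaw I := by
    classical
    have hm : AEMeasurable (fun ω => I.restrict (U · ω)) P :=
      aemeasurable_pi_lambda _ fun i => (h i).memLp_right.1.aemeasurable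
    -- Cramér–Wold: a linear functional of finitely many Wiener integrals is again a Wiener
    -- integral, hence Gaussian.
    refine ⟨isGaussian_of_map_eq_gaussianReal fun L => ?_⟩
    rw [AEMeasurable.map_map_of_aemeasurable (by fun_prop) hm]
    have hL : L ∘ (fun ω => I.restrict (U · ω)) =
        fun ω => ∑ i : I, L (fun j => if i = j then 1 else 0) * U i ω := by
      ext ω
      rw [Function.comp_apply, ← ContinuousLinearMap.coe_coe, LinearMap.pi_apply_eq_sum_univ]
      exact Finset.sum_congr rfl fun i _ => mul_comm _ _
    rw [hL]
    exact ⟨0, _, (IsHalfLineIntegral.sum hB Finset.univ fun (i : I) _ =>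
      (h i).const_mul (L fun j => if i = j then 1 else 0)).map_eq_gaussianReal hB⟩

end Gaussian

/-! ### The logarithmic time change -/

/-- The kernel of the Brownian motion on the line obtained by a logarithmic time change. -/
def logKernel (u x : ℝ) : ℝ :=
  (Iic 1).indicator (fun _ => 1) x + ((Ioc 1 (Real.exp u)).indicator (fun s => 1 / Real.sqrt s) x -
    (Ioc (Real.exp u) 1).indicator (fun s => 1 / Real.sqrt s) x)

/-- The constant part cancels, so increments across `u = 0` need no separate treatment later. -/
lemma logKernel_sub {a b : ℝ} (hab : a ≤ b) (x : ℝ) :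
    logKernel b x - logKernel a x =
      (Ioc (Real.exp a) (Real.exp b)).indicator (fun s => 1 / Real.sqrt s) x := by
  have := Real.exp_le_exp.2 hab
  simp only [logKernel, indicator_apply, mem_Ioc, mem_Iic]
  grind

section LogTimeChange

variable {Ω : Type*} [MeasurableSpace Ω] {P : Measure Ω} {B : ℝ≥0 → Ω → ℝ} {W : ℝ → Ω → ℝ}

lemma IsWienerIntegralOn.isHalfLineIntegral {S : Set ℝ} (hS : S ⊆ Ioi 0) {f : ℝ → ℝ} {Z : Ω → ℝ}
    (h : IsWienerIntegralOn (onLine B) P S f Z) : IsHalfLineIntegral B P (S.indicator f) Z := by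
  rwa [IsHalfLineIntegral, IsWienerIntegralOn, indicator_indicator, inter_eq_right.2 hS]

lemma IsHalfLineIntegral.isWienerIntegralOn {S : Set ℝ} (hS : S ⊆ Ioi 0) {f : ℝ → ℝ} {Z : Ω → ℝ}
    (h : IsHalfLineIntegral B P (S.indicator f) Z) : IsWienerIntegralOn (onLine B) P S f Z := by
  rwa [IsHalfLineIntegral, IsWienerIntegralOn, indicator_indicator, inter_eq_right.2 hS] at h

omit [MeasurableSpace Ω] in
lemma onLine_one : onLine B 1 = B 1 := by
  simp [onLine]

lemma IsLogTimeChange.isHalfLineIntegral (hB : IsPreBrownianReal B P)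
    (hW : IsLogTimeChange B W P) (u : ℝ) : IsHalfLineIntegral B P (logKernel u) (W u) := by
  have h1 := IsHalfLineIntegral.brownian hB 1
  rcases le_total 0 u with hu | hu
  · have h2 := (hW.of_nonneg u hu).isHalfLineIntegral
      (Ioc_subset_Ioi_self.trans (Ioi_subset_Ioi zero_le_one))
    refine (h1.add hB h2).congr (fun x _ => ?_) (Eventually.of_forall fun ω => ?_)
    · simp [logKernel, Ioc_eq_empty (not_lt.2 (Real.one_le_exp hu))]
    · simp [onLine_one]
  · have h2 := (hW.of_nonpos u hu).isHalfLineIntegral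
      (Ioc_subset_Ioi_self.trans (Ioi_subset_Ioi (Real.exp_pos u).le))
    refine (h1.sub hB h2).congr (fun x _ => ?_) (Eventually.of_forall fun ω => ?_)
    · simp [logKernel, Ioc_eq_empty (not_lt.2 (Real.exp_le_one_iff.2 hu)), sub_eq_add_neg]
    · simp [onLine_one]

lemma IsLogTimeChange.isHalfLineIntegral_sub (hB : IsPreBrownianReal B P)
    (hW : IsLogTimeChange B W P) {a b : ℝ} (hab : a ≤ b) :
    IsHalfLineIntegral B P ((Ioc (Real.exp a) (Real.exp b)).indicator fun s => 1 / Real.sqrt s)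
      (fun ω => W b ω - W a ω) :=
  ((hW.isHalfLineIntegral hB b).sub hB (hW.isHalfLineIntegral hB a)).congr
    (fun x _ => logKernel_sub hab x) (ae_eq_refl _)

lemma integral_indicator_sqrt_inv_sq {a b : ℝ} (hab : a ≤ b) :
    ∫ x, (Ioc (Real.exp a) (Real.exp b)).indicator (fun s => 1 / Real.sqrt s) x ^ 2 ∂halfLine =
      b - a := by
  have hsub : Ioc (Real.exp a) (Real.exp b) ⊆ Ioi 0 :=
    Ioc_subset_Ioi_self.trans (Ioi_subset_Ioi (Real.exp_pos a).le)
  have h : ∀ x, (Ioc (Real.exp a) (Real.exp b)).indicator (fun s => 1 / Real.sqrt s) x ^ 2 =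
      (Ioc (Real.exp a) (Real.exp b)).indicator (fun s => 1 / s) x := by
    intro x
    by_cases hx : x ∈ Ioc (Real.exp a) (Real.exp b)
    · rw [indicator_of_mem hx, indicator_of_mem hx, div_pow, one_pow,
        Real.sq_sqrt (mem_Ioi.1 (hsub hx)).le]
    · simp [hx]
  simp_rw [h]
  rw [integral_indicator measurableSet_Ioc, Measure.restrict_restrict measurableSet_Ioc,
    inter_eq_left.2 hsub, ← intervalIntegral.integral_of_le (Real.exp_le_exp.2 hab),
    integral_one_div_of_pos (Real.exp_pos a) (Real.exp_pos b), ← Real.exp_sub, Real.log_exp]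

/-- The logarithmic time change of a Brownian motion is a Brownian motion on the line. -/
lemma IsLogTimeChange.isBrownianOnLine (hB : IsPreBrownianReal B P)
    (hW : IsLogTimeChange B W P) : IsBrownianOnLine W P := by
  have := hB.isGaussianProcess.isProbabilityMeasure
  have hG := isGaussianProcess_of_isHalfLineIntegral hB (hW.isHalfLineIntegral hB)
  refine ⟨hG, fun u => (hW.isHalfLineIntegral hB u).integral_eq_zero hB, fun n t ht => ?_,
    fun u v => ?_, hW.cont⟩
  -- Jointly Gaussian increments are independent once uncorrelated; by the isometry the covariances
  -- vanish because the kernels have disjoint supports.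
  · refine hG.hasGaussianLaw_increments.iIndepFun_of_covariance_eq_zero fun i j hij => ?_
    have hi := fun i : Fin n => hW.isHalfLineIntegral_sub hB (ht (Fin.castSucc_le_succ i))
    rw [covariance_eq_sub (hi i).memLp_right (hi j).memLp_right, (hi i).integral_eq_zero hB,
      zero_mul, sub_zero]
    refine ((hi i).integral_mul hB (hi j)).trans ?_
    refine integral_eq_zero_of_ae (Eventually.of_forall fun x => ?_)
    have hdisj : ∀ {i j : Fin n}, i < j → Disjoint
        (Ioc (Real.exp (t i.castSucc)) (Real.exp (t i.succ)))
        (Ioc (Real.exp (t j.castSucc)) (Real.exp (t j.succ))) := by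
      intro i j hij
      refine Set.disjoint_left.2 fun x hx hx' => ?_
      have := Real.exp_le_exp.2 (ht (Fin.succ_le_castSucc_iff.2 hij))
      exact absurd (hx.2.trans this) (not_le.2 hx'.1)
    have hd : Disjoint (Ioc (Real.exp (t i.castSucc)) (Real.exp (t i.succ)))
        (Ioc (Real.exp (t j.castSucc)) (Real.exp (t j.succ))) := by
      rcases lt_or_gt_of_ne hij with h | h
      · exact hdisj h
      · exact (hdisj h).symm
    by_cases hx : x ∈ Ioc (Real.exp (t i.castSucc)) (Real.exp (t i.succ))
    · simp [indicator_of_notMem (Set.disjoint_left.1 hd hx)]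
    · simp [indicator_of_notMem hx]
  · rcases le_total v u with h | h
    · rw [(hW.isHalfLineIntegral_sub hB h).integral_sq hB, integral_indicator_sqrt_inv_sq h,
        abs_of_nonneg (by linarith)]
    · simp_rw [fun ω => sub_sq_comm (W u ω) (W v ω)]
      rw [(hW.isHalfLineIntegral_sub hB h).integral_sq hB, integral_indicator_sqrt_inv_sq h,
        abs_of_nonpos (by linarith), neg_sub]

end LogTimeChange

/-! ### Wiener integrals with respect to the time-changed Brownian motion -/

/-- Under `x = e^y` the Jacobian `e^y` cancels the square of `1/√x`. -/
lemma eLpNorm_comp_log (g : ℝ → ℝ) :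
    eLpNorm (fun x => g (Real.log x) / Real.sqrt x) 2 halfLine = eLpNorm g 2 volume := by
  rw [eLpNorm_eq_lintegral_rpow_enorm_toReal (by norm_num) (by norm_num),
    eLpNorm_eq_lintegral_rpow_enorm_toReal (by norm_num) (by norm_num)]
  congr 1
  have himg : Ioi (0 : ℝ) = Real.exp '' univ := by rw [image_univ, Real.range_exp]
  rw [halfLine, himg, lintegral_image_eq_lintegral_abs_deriv_mul MeasurableSet.univ
    (fun x _ => (Real.hasDerivAt_exp x).hasDerivWithinAt) Real.exp_injective.injOn,
    Measure.restrict_univ]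
  refine lintegral_congr fun x => ?_
  have h : Real.exp x * (g x / Real.sqrt (Real.exp x)) ^ 2 = g x ^ 2 := by
    rw [div_pow, Real.sq_sqrt (Real.exp_pos x).le]
    field_simp
  rw [Real.log_exp, Real.abs_exp, ← abs_of_pos (Real.exp_pos x), ← Real.norm_eq_abs,
    ofReal_norm, Real.norm_eq_abs, abs_of_pos (Real.exp_pos x)]
  simp only [ENNReal.toReal_ofNat, ENNReal.rpow_ofNat, ← enorm_pow]
  rw [← enorm_mul, h]

section

variable {Ω : Type*} [MeasurableSpace Ω] {P : Measure Ω} {B : ℝ≥0 → Ω → ℝ} {W : ℝ → Ω → ℝ}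
  {f g : ℝ → ℝ} {Y Z : Ω → ℝ}

lemma IsHalfLineIntegral.congr_ae (h : IsHalfLineIntegral B P f Y) (hf : f =ᵐ[halfLine] g)
    (hY : Y =ᵐ[P] Z) : IsHalfLineIntegral B P g Z := by
  refine IsWienerIntegral.congr h ?_ hY
  filter_upwards [(ae_restrict_iff' measurableSet_Ioi).1 hf] with x hx
  by_cases hx' : x ∈ Ioi (0 : ℝ)
  · rw [indicator_of_mem hx', indicator_of_mem hx', hx hx']
  · rw [indicator_of_notMem hx', indicator_of_notMem hx']

lemma IsLogTimeChange.isHalfLineIntegral_stepIntegral (hB : IsPreBrownianReal B P)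
    (hW : IsLogTimeChange B W P) (φ : StepData) :
    IsHalfLineIntegral B P (fun x => φ.toFun (Real.log x) / Real.sqrt x) (φ.integral W) := by
  refine (IsHalfLineIntegral.sum hB Finset.univ fun i _ =>
    (hW.isHalfLineIntegral_sub hB (φ.le i)).const_mul (φ.c i)).congr (fun x hx => ?_)
    (ae_eq_refl _)
  rw [StepData.toFun, Finset.sum_div]
  refine Finset.sum_congr rfl fun i _ => ?_
  have : x ∈ Ioc (Real.exp (φ.a i)) (Real.exp (φ.b i)) ↔
      Real.log x ∈ Ioc (φ.a i) (φ.b i) := by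
    rw [mem_Ioc, mem_Ioc, Real.lt_log_iff_exp_lt hx, Real.log_le_iff_le_exp hx]
  by_cases h : Real.log x ∈ Ioc (φ.a i) (φ.b i)
  · rw [indicator_of_mem (this.2 h), indicator_of_mem h, mul_one_div]
  · rw [indicator_of_notMem (fun hx' => h (this.1 hx')), indicator_of_notMem h, mul_zero, zero_div]

/-- Change of variables in a Wiener integral under the logarithmic time change. -/
lemma IsLogTimeChange.isWienerIntegral (hB : IsPreBrownianReal B P)
    (hW : IsLogTimeChange B W P) (hg : MemLp g 2 volume)
    (h : IsHalfLineIntegral B P (fun x => g (Real.log x) / Real.sqrt x) Z) :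
    IsWienerIntegral W P g Z := by
  refine ⟨hg, h.memLp_right, fun ε hε => ?_⟩
  obtain ⟨φ, hφ⟩ := exists_stepData_eLpNorm_sub_lt hg hε
  refine ⟨φ, hφ, ?_⟩
  -- By the isometry, the error of the elementary `W`-integral equals the `L²` distance between `g`
  -- and `φ`.
  rw [(h.sub hB (hW.isHalfLineIntegral_stepIntegral hB φ)).eLpNorm_eq hB]
  simp_rw [← sub_div]
  rwa [eLpNorm_comp_log fun t => g t - φ.toFun t]

end

/-! ### The Müntz kernel -/

section Kernel

variable {n : ℕ} (lam : Fin n → ℝ)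

lemma measurable_muntzK : Measurable (muntzK lam) := by
  unfold muntzK
  fun_prop

lemma measurable_muntzKernel : Measurable (Function.uncurry (muntzKernel lam)) := by
  have : Function.uncurry (muntzKernel lam) = fun p : ℝ × ℝ =>
      if p.2 ≤ p.1 then p.1⁻¹ * muntzK lam (p.2 / p.1) else 0 := rfl
  rw [this]
  refine Measurable.ite (measurableSet_le measurable_snd measurable_fst) ?_ measurable_const
  exact measurable_fst.inv.mul ((measurable_muntzK lam).comp (measurable_snd.div measurable_fst))

/-- The Müntz kernel, cut off at `0`. -/
def cutKernel (s : ℝ) : ℝ → ℝ := (Ioc 0 s).indicator (muntzKernel lam s)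

lemma measurable_cutKernel : Measurable (Function.uncurry (cutKernel lam)) := by
  have : Function.uncurry (cutKernel lam) =
      {p : ℝ × ℝ | 0 < p.2 ∧ p.2 ≤ p.1}.indicator (Function.uncurry (muntzKernel lam)) := by
    ext ⟨s, v⟩
    simp [cutKernel, Function.uncurry, indicator_apply]
  rw [this]
  exact (measurable_muntzKernel lam).indicator ((measurableSet_lt measurable_const
    measurable_snd).inter (measurableSet_le measurable_snd measurable_fst))

lemma cutKernel_of_mem {s v : ℝ} (h : v ∈ Ioc 0 s) :
    cutKernel lam s v = s⁻¹ * muntzK lam (v / s) := by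
  rw [cutKernel, indicator_of_mem h, muntzKernel, if_pos h.2]

/-- Homogeneity of degree `-1` with `v = s x`. Thus the norm of the kernel is a constant times
`s^{-1/2}`, integrable at `0`, as stochastic Fubini requires. -/
lemma integral_cutKernel_sq {s : ℝ} (hs : 0 < s) :
    ∫ v, cutKernel lam s v ^ 2 ∂halfLine = s⁻¹ * ∫ x in (0 : ℝ)..1, muntzK lam x ^ 2 := by
  have h : ∀ v, cutKernel lam s v ^ 2 =
      (Ioc 0 s).indicator (fun v => (s⁻¹) ^ 2 * muntzK lam (v / s) ^ 2) v := by
    intro v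
    by_cases hv : v ∈ Ioc 0 s
    · rw [cutKernel_of_mem lam hv, indicator_of_mem hv, mul_pow]
    · rw [cutKernel, indicator_of_notMem hv, indicator_of_notMem hv, zero_pow two_ne_zero]
  simp_rw [h]
  rw [integral_indicator measurableSet_Ioc, Measure.restrict_restrict measurableSet_Ioc,
    inter_eq_left.2 Ioc_subset_Ioi_self, ← intervalIntegral.integral_of_le hs.le,
    intervalIntegral.integral_const_mul,
    intervalIntegral.integral_comp_div (fun x => muntzK lam x ^ 2) hs.ne', zero_div,
    div_self hs.ne', smul_eq_mul]
  field_simp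

lemma lintegral_ofReal_sqrt_inv_mul_lt_top (c t : ℝ) :
    ∫⁻ s in Ioc 0 t, ENNReal.ofReal (Real.sqrt (s⁻¹ * c)) < ∞ := by
  rcases le_total t 0 with ht | ht
  · simp [Ioc_eq_empty (not_lt.2 ht)]
  have h1 : IntegrableOn (fun s : ℝ => Real.sqrt c * s ^ (-(1 / 2) : ℝ)) (Ioc 0 t) :=
    ((intervalIntegrable_iff_integrableOn_Ioc_of_le ht).1
      (intervalIntegral.intervalIntegrable_rpow' (by norm_num))).const_mul _
  refine lt_of_eq_of_lt (setLIntegral_congr_fun measurableSet_Ioc fun s hs => ?_)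
    h1.lintegral_lt_top
  rw [Real.sqrt_mul (inv_nonneg.2 hs.1.le), mul_comm, Real.rpow_neg hs.1.le, Real.sqrt_inv,
    Real.sqrt_eq_rpow s]

lemma lintegral_eLpNorm_cutKernel_lt_top (h : ∀ s, 0 < s → MemLp (cutKernel lam s) 2 halfLine)
    (t : ℝ) : ∫⁻ s in Ioc 0 t, eLpNorm (cutKernel lam s) 2 halfLine < ∞ := by
  refine lt_of_eq_of_lt (setLIntegral_congr_fun measurableSet_Ioc fun s hs => ?_)
    (lintegral_ofReal_sqrt_inv_mul_lt_top (∫ x in (0 : ℝ)..1, muntzK lam x ^ 2) t)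
  rw [eLpNorm_two_eq_ofReal (h s hs.1), integral_cutKernel_sq lam hs.1]

/-- The substitution `s = v r` removes the homogeneity; this is how `muntzRho` enters. -/
lemma integral_cutKernel {t v : ℝ} (hv : 0 < v) :
    ∫ s in Ioc 0 t, cutKernel lam s v =
      (Iic t).indicator (fun v => ∫ r in (1 : ℝ)..t / v, muntzK lam (1 / r) / r) v := by
  have h : ∀ s, cutKernel lam s v = (Ici v).indicator (fun s => s⁻¹ * muntzK lam (v / s)) s := by
    intro s
    by_cases hs : v ≤ s
    · rw [cutKernel_of_mem lam ⟨hv, hs⟩, indicator_of_mem (mem_Ici.2 hs)]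
    · rw [cutKernel, indicator_of_notMem fun h => hs h.2, indicator_of_notMem (notMem_Ici.2 (not_le.1 hs))]
  simp_rw [h]
  rw [setIntegral_indicator measurableSet_Ici]
  have hset : Ioc 0 t ∩ Ici v = Icc v t := by
    ext s
    simp only [mem_inter_iff, mem_Ioc, mem_Ici, mem_Icc]
    exact ⟨fun h => ⟨h.2, h.1.2⟩, fun h => ⟨⟨hv.trans_le h.1, h.2⟩, h.1⟩⟩
  rw [hset]
  by_cases hvt : v ≤ t
  · rw [indicator_of_mem (mem_Iic.2 hvt), integral_Icc_eq_integral_Ioc,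
      ← intervalIntegral.integral_of_le hvt]
    have h2 := intervalIntegral.integral_comp_mul_left (a := 1) (b := t / v)
      (fun s => s⁻¹ * muntzK lam (v / s)) hv.ne'
    rw [mul_one, mul_div_cancel₀ _ hv.ne', smul_eq_mul, eq_inv_mul_iff_mul_eq₀ hv.ne',
      ← intervalIntegral.integral_const_mul] at h2
    rw [← h2]
    congr with r
    rw [mul_inv, ← mul_assoc, mul_inv_cancel_left₀ hv.ne', div_mul_cancel_left₀ hv.ne', one_div]
    ring
  · rw [indicator_of_notMem (notMem_Iic.2 (not_le.1 hvt)), Icc_eq_empty hvt, Measure.restrict_empty, integral_zero_measure]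

end Kernel

/-! ### The moving-average representation -/

section MovingAverage

variable {Ω : Type*} [MeasurableSpace Ω] {P : Measure Ω} {B X : ℝ≥0 → Ω → ℝ} {W : ℝ → Ω → ℝ}
  {n : ℕ} {lam : Fin n → ℝ}

lemma IsVolterraTransform.isHalfLineIntegral (hB : IsPreBrownianReal B P)
    (hX : IsVolterraTransform (muntzKernel lam) B X P) (t : ℝ≥0) :
    IsHalfLineIntegral B P ((Iic (t : ℝ)).indicator fun v => muntzRho lam (t / v)) (X t) := by
  have := hB.isGaussianProcess.isProbabilityMeasure
  obtain ⟨Y, hYm, hY, hXY⟩ := hX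
  -- Square integrability of the kernel is part of what it means for `Y s` to be its Wiener
  -- integral, so no bound on `lam` is needed here.
  have hY' : ∀ s, 0 < s → IsHalfLineIntegral B P (cutKernel lam s) (Y s) := fun s hs =>
    (hY s hs).isHalfLineIntegral Ioc_subset_Ioi_self
  have hfub : IsHalfLineIntegral B P (fun v => ∫ s in Ioc 0 (t : ℝ), cutKernel lam s v)
      (fun ω => ∫ s in Ioc 0 (t : ℝ), Y s ω) := by
    refine IsHalfLineIntegral.integral_fubini hB ?_
      (measurable_cutKernel lam).aestronglyMeasurable (hYm.mono_ac ?_)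
      (lintegral_eLpNorm_cutKernel_lt_top lam (fun s hs => (hY' s hs).memLp) t).ne
    · filter_upwards [ae_restrict_mem measurableSet_Ioc] with s hs using hY' s hs.1
    · exact (Measure.restrict_mono Ioc_subset_Ioi_self le_rfl).absolutelyContinuous.prod .rfl
  refine ((IsHalfLineIntegral.brownian hB t).sub hB hfub).congr (fun v hv => ?_) ?_
  · rw [integral_cutKernel lam hv]
    by_cases h : v ∈ Iic (t : ℝ)
    · simp only [indicator_of_mem h, muntzRho]
    · simp only [indicator_of_notMem h, sub_zero]
  · filter_upwards [hXY] with ω hω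
    rw [(hω t).2, onLine, Real.toNNReal_coe]

lemma IsVolterraTransform.isWienerIntegralOn_timeChange (hB : IsPreBrownianReal B P)
    (hX : IsVolterraTransform (muntzKernel lam) B X P) (hW : IsLogTimeChange B W P)
    (hη : MemLp (muntzEta lam) 2 volume) (u : ℝ) :
    IsWienerIntegralOn W P (Iic u) (fun v => muntzEta lam (u - v)) (timeChange X u) := by
  refine hW.isWienerIntegral hB ?_ ?_
  · exact (hη.comp_measurePreserving (Measure.measurePreserving_sub_left volume u)).indicator
      measurableSet_Iic
  refine ((hX.isHalfLineIntegral hB (Real.exp u).toNNReal).const_mul (Real.exp (-u / 2))).congr_ae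
    ?_ (ae_eq_refl _)
  -- The point `x = e^u` is discarded: there `muntzEta` takes the value `0` at its jump, while
  -- `muntzRho` equals `1`.
  filter_upwards [ae_restrict_mem measurableSet_Ioi,
    Measure.ae_ne halfLine (Real.exp u)] with x hx hxu
  rw [Real.coe_toNNReal _ (Real.exp_pos u).le]
  have hx0 : 0 < x := hx
  rcases lt_or_gt_of_ne hxu with h | h
  · have hlog : Real.log x < u := (Real.log_lt_iff_lt_exp hx0).2 h
    rw [indicator_of_mem (mem_Iic.2 h.le), indicator_of_mem (mem_Iic.2 hlog.le), muntzEta,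
      if_pos (sub_pos.2 hlog), Real.exp_sub, Real.exp_log hx0]
    have : Real.exp (-(u - Real.log x) / 2) = Real.exp (-u / 2) * Real.sqrt x := by
      rw [Real.sqrt_eq_rpow, Real.rpow_def_of_pos hx0, ← Real.exp_add]
      congr 1
      ring
    rw [this]
    have := Real.sqrt_pos.2 hx0
    field_simp
  · have hlog : u < Real.log x := (Real.lt_log_iff_exp_lt hx0).2 h
    rw [indicator_of_notMem (notMem_Iic.2 h), indicator_of_notMem (notMem_Iic.2 hlog), mul_zero,
      zero_div]

end MovingAverage

/-! ### Existence of the transforms -/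

section Existence

variable {Ω : Type*} [MeasurableSpace Ω] {P : Measure Ω} {B : ℝ≥0 → Ω → ℝ}

/-- `V` is a version of the Brownian motion `B`, extended to the line, that is measurable at each
time and continuous everywhere. -/
structure IsContinuousVersion (B : ℝ≥0 → Ω → ℝ) (V : ℝ → Ω → ℝ) (P : Measure Ω) : Prop where
  continuous : ∀ ω, Continuous fun t => V t ω
  measurable : ∀ t, Measurable (V t)
  ae_eq : ∀ᵐ ω ∂P, ∀ t, V t ω = onLine B t ω

/-- Set the paths to zero on a measurable null set outside which they are continuous and agree with
measurable versions at all rational times. Measurability at a real time follows by taking limits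
along rationals. -/
lemma exists_isContinuousVersion (hB : IsBrownianReal B P) :
    ∃ V, IsContinuousVersion B V P := by
  have hm : ∀ t : ℝ, AEMeasurable (onLine B t) P := fun t => hB.aemeasurable _
  set g : ℚ → Ω → ℝ := fun q => (hm q).mk _ with hg
  have hgood : ∀ᵐ ω ∂P, (Continuous fun t : ℝ => onLine B t ω) ∧
      ∀ q : ℚ, onLine B q ω = g q ω := by
    filter_upwards [hB.cont, ae_all_iff.2 fun q : ℚ => (hm q).ae_eq_mk] with ω h1 h2
    exact ⟨h1.comp continuous_real_toNNReal, h2⟩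
  obtain ⟨N, hN, hNm, hNP⟩ := exists_measurable_superset_of_null hgood
  have hNgood : ∀ ω ∈ Nᶜ, (Continuous fun t : ℝ => onLine B t ω) ∧
      ∀ q : ℚ, onLine B q ω = g q ω := fun ω hω => by
    by_contra h
    exact hω (hN h)
  have hcont : ∀ ω, Continuous fun t => Nᶜ.indicator (onLine B t) ω := by
    intro ω
    by_cases hω : ω ∈ Nᶜ
    · simpa only [indicator_of_mem hω] using (hNgood ω hω).1
    · simpa only [indicator_of_notMem hω] using continuous_const
  refine ⟨fun t => Nᶜ.indicator (onLine B t), hcont, fun t => ?_, ?_⟩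
  · obtain ⟨x, hx, hxt⟩ := mem_closure_iff_seq_limit.1 (Rat.denseRange_cast (𝕜 := ℝ) t)
    choose q hq using hx
    refine measurable_of_tendsto_metrizable (f := fun k => Nᶜ.indicator (g (q k))) (fun k =>
      (hm (q k)).measurable_mk.indicator hNm.compl) (tendsto_pi_nhds.2 fun ω => ?_)
    have h := ((hcont ω).tendsto t).comp hxt
    refine h.congr fun k => ?_
    by_cases hω : ω ∈ Nᶜ
    · simp only [Function.comp_apply, indicator_of_mem hω, ← hq, (hNgood ω hω).2]
    · simp only [Function.comp_apply, indicator_of_notMem hω]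
  · filter_upwards [measure_eq_zero_iff_ae_notMem.1 hNP] with ω hω t
    exact indicator_of_mem (mem_compl hω) _

namespace IsContinuousVersion

variable {V : ℝ → Ω → ℝ}

lemma stronglyMeasurable (hV : IsContinuousVersion B V P) :
    StronglyMeasurable (Function.uncurry V) :=
  stronglyMeasurable_uncurry_of_continuous_of_stronglyMeasurable hV.continuous
    fun t => (hV.measurable t).stronglyMeasurable

lemma isHalfLineIntegral (hB : IsPreBrownianReal B P) (hV : IsContinuousVersion B V P) (t : ℝ) :
    IsHalfLineIntegral B P ((Iic t).indicator fun _ => 1) (V t) :=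
  (IsHalfLineIntegral.brownian hB t).congr (fun _ _ => rfl)
    (hV.ae_eq.mono fun _ h => (h t).symm)

/-- Pathwise integrals of a Brownian motion as Wiener integrals. -/
lemma isHalfLineIntegral_integral (hB : IsPreBrownianReal B P) (hV : IsContinuousVersion B V P)
    {ν : Measure ℝ} [SFinite ν] {c τ : ℝ → ℝ} (hc : Measurable c) (hτ : Measurable τ)
    (hfin : ∫⁻ r, ENNReal.ofReal (|c r| * Real.sqrt (τ r)) ∂ν ≠ ∞) :
    IsHalfLineIntegral B P (fun x => ∫ r, c r * (Iic (τ r)).indicator (fun _ => 1) x ∂ν)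
      (fun ω => ∫ r, c r * V (τ r) ω ∂ν) := by
  have := hB.isGaussianProcess.isProbabilityMeasure
  have hr : ∀ r, IsHalfLineIntegral B P (fun x => c r * (Iic (τ r)).indicator (fun _ => 1) x)
      (fun ω => c r * V (τ r) ω) := fun r => (hV.isHalfLineIntegral hB (τ r)).const_mul (c r)
  refine IsHalfLineIntegral.integral_fubini hB (Eventually.of_forall hr) ?_ ?_ ?_
  · have : Function.uncurry (fun r x => c r * (Iic (τ r)).indicator (fun _ => (1 : ℝ)) x) =
        fun p : ℝ × ℝ => c p.1 * {p : ℝ × ℝ | p.2 ≤ τ p.1}.indicator (fun _ => 1) p := rfl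
    rw [this]
    exact ((hc.comp measurable_fst).mul (measurable_const.indicator
      (measurableSet_le measurable_snd (hτ.comp measurable_fst)))).aestronglyMeasurable
  · refine ((hc.comp measurable_fst).stronglyMeasurable.mul
      (hV.stronglyMeasurable.comp_measurable (g := fun p : ℝ × Ω => (τ p.1, p.2))
        ((hτ.comp measurable_fst).prodMk measurable_snd))).aestronglyMeasurable
  -- The kernel `c 1_{(0,τ]}` has norm `|c| √τ`.
  · convert hfin using 3 with r
    rw [eLpNorm_two_eq_ofReal (hr r).memLp]
    congr 1
    simp_rw [mul_pow]
    have h1 : ∀ x : ℝ, (Iic (τ r)).indicator (fun _ => (1 : ℝ)) x ^ 2 =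
        (Iic (τ r)).indicator (fun _ => 1) x := by
      intro x
      by_cases hx : x ∈ Iic (τ r) <;> simp [hx]
    simp_rw [h1]
    rw [integral_const_mul, integral_indicator measurableSet_Iic, restrict_halfLine_Iic,
      Real.sqrt_mul (sq_nonneg _), Real.sqrt_sq_eq_abs]
    congr 1
    rcases le_total 0 (τ r) with h | h
    · simp [h]
    · simp [Real.sqrt_eq_zero_of_nonpos h, Ioc_eq_empty (not_lt.2 h)]

lemma integral_half_exp (a b : ℝ) :
    ∫ r in a..b, 1 / 2 * Real.exp (-r / 2) = Real.exp (-a / 2) - Real.exp (-b / 2) := by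
  have h : ∀ r, HasDerivAt (fun r => -Real.exp (-r / 2)) (1 / 2 * Real.exp (-r / 2)) r := by
    intro r
    refine (((hasDerivAt_id r).neg.div_const 2).exp).neg.congr_deriv ?_
    simp only [Pi.neg_apply, id]
    ring
  rw [intervalIntegral.integral_eq_sub_of_hasDerivAt (fun r _ => h r)
    (Continuous.intervalIntegrable (by fun_prop) _ _)]
  ring

/-- Integration by parts at the level of kernels: for `a < y ≤ b`, `e^{-y/2} = e^{-b/2} + ∫_y^b ½
e^{-r/2} dr` with `y = log x`. -/
lemma logKernel_eq {a b x : ℝ} (hab : a ≤ b) (hx : 0 < x) :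
    Real.exp (-b / 2) * (Iic (Real.exp b)).indicator (fun _ => 1) x -
      Real.exp (-a / 2) * (Iic (Real.exp a)).indicator (fun _ => 1) x +
      ∫ r in Ioc a b, 1 / 2 * Real.exp (-r / 2) * (Iic (Real.exp r)).indicator (fun _ => 1) x =
    (Ioc (Real.exp a) (Real.exp b)).indicator (fun s => 1 / Real.sqrt s) x := by
  obtain ⟨y, rfl⟩ : ∃ y, x = Real.exp y := ⟨Real.log x, (Real.exp_log hx).symm⟩
  have hsq : 1 / Real.sqrt (Real.exp y) = Real.exp (-y / 2) := by
    rw [Real.sqrt_eq_rpow, ← Real.exp_mul, one_div, ← Real.exp_neg]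
    congr 1
    ring
  have h1 : ∀ r, 1 / 2 * Real.exp (-r / 2) * (Iic (Real.exp r)).indicator (fun _ => 1) (Real.exp y) =
      (Ici y).indicator (fun r => 1 / 2 * Real.exp (-r / 2)) r := by
    intro r
    by_cases h : y ≤ r <;> simp [h]
  simp_rw [h1]
  rw [setIntegral_indicator measurableSet_Ici]
  simp only [indicator_apply, mem_Iic, mem_Ioc, Real.exp_le_exp, Real.exp_lt_exp, hsq]
  rcases le_or_gt y a with ha | ha
  · rw [inter_eq_left.2 (fun r hr => mem_Ici.2 (ha.trans hr.1.le)), ← intervalIntegral.integral_of_le hab,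
      integral_half_exp]
    simp [ha, ha.trans hab, not_lt.2 ha]
  · have hset : Ioc a b ∩ Ici y = Icc y b := by
      ext r
      simp only [mem_inter_iff, mem_Ioc, mem_Ici, mem_Icc]
      exact ⟨fun h => ⟨h.2, h.1.2⟩, fun h => ⟨⟨ha.trans_le h.1, h.2⟩, h.1⟩⟩
    rw [hset]
    rcases le_or_gt y b with hb | hb
    · rw [integral_Icc_eq_integral_Ioc, ← intervalIntegral.integral_of_le hb, integral_half_exp]
      simp [hb, ha, not_le.2 ha]
    · simp [not_le.2 ha, not_le.2 hb]

lemma isHalfLineIntegral_sub (hB : IsPreBrownianReal B P) (hV : IsContinuousVersion B V P)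
    {a b : ℝ} (hab : a ≤ b) :
    IsHalfLineIntegral B P ((Ioc (Real.exp a) (Real.exp b)).indicator fun s => 1 / Real.sqrt s)
      (fun ω => Real.exp (-b / 2) * V (Real.exp b) ω - Real.exp (-a / 2) * V (Real.exp a) ω +
        ∫ r in Ioc a b, 1 / 2 * Real.exp (-r / 2) * V (Real.exp r) ω) := by
  have h1 := fun u => (hV.isHalfLineIntegral hB (Real.exp u)).const_mul (Real.exp (-u / 2))
  refine (((h1 b).sub hB (h1 a)).add hB (hV.isHalfLineIntegral_integral hB
    (ν := volume.restrict (Ioc a b)) (c := fun r => 1 / 2 * Real.exp (-r / 2)) (τ := Real.exp)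
    (by fun_prop) Real.measurable_exp ?_)).congr (fun x hx => logKernel_eq hab hx) (ae_eq_refl _)
  have : Continuous fun r => |1 / 2 * Real.exp (-r / 2)| * Real.sqrt (Real.exp r) := by fun_prop
  exact ((this.integrableOn_Icc (a := a) (b := b)).mono_set
    Ioc_subset_Icc_self).lintegral_lt_top.ne

end IsContinuousVersion

lemma exists_isLogTimeChange (hB : IsBrownianReal B P) : ∃ W, IsLogTimeChange B W P := by
  obtain ⟨V, hV⟩ := exists_isContinuousVersion hB
  have hVc := hV.continuous
  have hc : ∀ ω, Continuous fun r => 1 / 2 * Real.exp (-r / 2) * V (Real.exp r) ω := fun ω => by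
    have := hVc ω
    fun_prop
  have h1 : ∀ᵐ ω ∂P, V 1 ω = B 1 ω := hV.ae_eq.mono fun ω h => by rw [h 1, onLine_one]
  -- `∫ dB_s/√s` integrated by parts with `s = e^r`; the value at `u = 0` is `V_1`, and continuity
  -- holds for every `ω`.
  refine ⟨fun u ω => Real.exp (-u / 2) * V (Real.exp u) ω +
    ∫ r in (0 : ℝ)..u, 1 / 2 * Real.exp (-r / 2) * V (Real.exp r) ω, fun u hu => ?_,
    fun u hu => ?_, Eventually.of_forall fun ω => ?_⟩
  · have h := hV.isHalfLineIntegral_sub hB.toIsPreBrownianReal hu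
    rw [Real.exp_zero] at h
    refine IsHalfLineIntegral.isWienerIntegralOn
      (Ioc_subset_Ioi_self.trans (Ioi_subset_Ioi zero_le_one))
      (h.congr (fun _ _ => rfl) ?_)
    filter_upwards [h1] with ω hω
    rw [intervalIntegral.integral_of_le hu, ← hω]
    simp
    ring
  · have h := hV.isHalfLineIntegral_sub hB.toIsPreBrownianReal hu
    rw [Real.exp_zero] at h
    refine IsHalfLineIntegral.isWienerIntegralOn
      (Ioc_subset_Ioi_self.trans (Ioi_subset_Ioi (Real.exp_pos u).le))
      (h.congr (fun _ _ => rfl) ?_)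
    filter_upwards [h1] with ω hω
    rw [intervalIntegral.integral_of_ge hu, ← hω]
    simp
    ring
  · have := hVc ω
    exact (by fun_prop : Continuous fun u => Real.exp (-u / 2) * V (Real.exp u) ω).add
      (intervalIntegral.continuous_primitive (fun a b => (hc ω).intervalIntegrable a b) 0)

/-- A pathwise formula for the Wiener integral `∫_0^s v ^ a dB_v`. -/
def powerIntegral (V : ℝ → Ω → ℝ) (a s : ℝ) (ω : Ω) : ℝ :=
  s ^ a * V s ω - ∫ v in Ioc 0 s, a * v ^ (a - 1) * V v ω

lemma IsContinuousVersion.stronglyMeasurable_powerIntegral {V : ℝ → Ω → ℝ}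
    (hV : IsContinuousVersion B V P) (a : ℝ) :
    StronglyMeasurable (Function.uncurry (powerIntegral V a)) := by
  have h1 : StronglyMeasurable fun p : ℝ × Ω => p.1 ^ a :=
    (measurable_fst.pow_const a).stronglyMeasurable
  refine (h1.mul hV.stronglyMeasurable).sub ?_
  have h2 : ∀ p : ℝ × Ω, ∫ v in Ioc 0 p.1, a * v ^ (a - 1) * V v p.2 =
      ∫ v, {q : (ℝ × Ω) × ℝ | 0 < q.2 ∧ q.2 ≤ q.1.1}.indicator
        (fun q => a * q.2 ^ (a - 1) * V q.2 q.1.2) (p, v) := by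
    intro p
    rw [← integral_indicator measurableSet_Ioc]
    rfl
  simp only [h2]
  refine StronglyMeasurable.integral_prod_right' ?_
  refine StronglyMeasurable.indicator ?_ ((measurableSet_lt measurable_const measurable_snd).inter
    (measurableSet_le measurable_snd measurable_fst.fst))
  exact ((measurable_snd.pow_const _).const_mul a).stronglyMeasurable.mul
    (hV.stronglyMeasurable.comp_measurable (g := fun q : (ℝ × Ω) × ℝ => (q.2, q.1.2))
      (by fun_prop))

/-- On kernels this reads `x^a = s^a - ∫_x^s a v^{a-1} dv`. The Fubini condition is integrability of
`|a| v^{a-1/2}` near `0`, which is where `a > -1/2` enters. -/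
lemma IsContinuousVersion.isHalfLineIntegral_powerIntegral {V : ℝ → Ω → ℝ}
    (hB : IsPreBrownianReal B P) (hV : IsContinuousVersion B V P) {a s : ℝ} (ha : -1 / 2 < a) :
    IsHalfLineIntegral B P ((Iic s).indicator fun x => x ^ a) (powerIntegral V a s) := by
  refine (((hV.isHalfLineIntegral hB s).const_mul (s ^ a)).sub hB
    (hV.isHalfLineIntegral_integral hB (ν := volume.restrict (Ioc 0 s))
      (c := fun v => a * v ^ (a - 1)) (τ := id) ?_ measurable_id ?_)).congr (fun x hx => ?_)
    (ae_eq_refl _)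
  · exact (measurable_id.pow_const _).const_mul a
  · rcases le_total s 0 with hs | hs
    · simp [Ioc_eq_empty (not_lt.2 hs)]
    have h1 : IntegrableOn (fun v : ℝ => |a| * v ^ (a - 1 / 2)) (Ioc 0 s) :=
      ((intervalIntegrable_iff_integrableOn_Ioc_of_le hs).1
        (intervalIntegral.intervalIntegrable_rpow' (by linarith))).const_mul _
    refine (lt_of_eq_of_lt (setLIntegral_congr_fun measurableSet_Ioc fun v hv => ?_)
      h1.lintegral_lt_top).ne
    rw [abs_mul, abs_of_nonneg (Real.rpow_nonneg hv.1.le _), mul_assoc, id, Real.sqrt_eq_rpow,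
      ← Real.rpow_add hv.1]
    congr 3
    ring
  · have h1 : ∀ v, a * v ^ (a - 1) * (Iic (id v)).indicator (fun _ => (1 : ℝ)) x =
        (Ici x).indicator (fun v => a * v ^ (a - 1)) v := by
      intro v
      by_cases h : x ≤ v <;> simp [h]
    simp_rw [h1]
    rw [setIntegral_indicator measurableSet_Ici]
    have hset : Ioc 0 s ∩ Ici x = Icc x s := by
      ext r
      simp only [mem_inter_iff, mem_Ioc, mem_Ici, mem_Icc]
      exact ⟨fun h => ⟨h.2, h.1.2⟩, fun h => ⟨⟨hx.trans_le h.1, h.2⟩, h.1⟩⟩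
    rw [hset]
    rcases le_or_gt x s with hs | hs
    · have hpos : ∀ v ∈ uIcc x s, 0 < v := fun v hv => by
        rw [uIcc_of_le hs] at hv
        exact hx.trans_le hv.1
      rw [integral_Icc_eq_integral_Ioc, ← intervalIntegral.integral_of_le hs,
        intervalIntegral.integral_eq_sub_of_hasDerivAt
          (fun v hv => Real.hasDerivAt_rpow_const (Or.inl (hpos v hv).ne'))]
      · simp [hs]
      · refine ContinuousOn.intervalIntegrable fun v hv => ContinuousAt.continuousWithinAt ?_
        exact (Real.continuousAt_rpow_const _ _ (Or.inl (hpos v hv).ne')).const_mul a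
    · simp [not_le.2 hs]

lemma exists_isVolterraTransform (hB : IsBrownianReal B P) {n : ℕ} {lam : Fin n → ℝ}
    (hlam : ∀ j, -1 / 2 < lam j) : ∃ X, IsVolterraTransform (muntzKernel lam) B X P := by
  have hB' := hB.toIsPreBrownianReal
  have := hB'.isGaussianProcess.isProbabilityMeasure
  obtain ⟨V, hV⟩ := exists_isContinuousVersion hB
  set Y : ℝ → Ω → ℝ := fun s ω =>
    ∑ j, s⁻¹ * muntzCoeff lam j * s ^ (-lam j) * powerIntegral V (lam j) s ω with hYdef
  have hYm : StronglyMeasurable (Function.uncurry Y) := by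
    have : Function.uncurry Y = fun p : ℝ × Ω => ∑ j, p.1⁻¹ * muntzCoeff lam j *
      p.1 ^ (-lam j) * Function.uncurry (powerIntegral V (lam j)) p := rfl
    rw [this]
    refine Finset.stronglyMeasurable_fun_sum _ fun j _ => StronglyMeasurable.mul ?_
      (hV.stronglyMeasurable_powerIntegral (lam j))
    exact ((measurable_fst.inv.mul_const _).mul (measurable_fst.pow_const _)).stronglyMeasurable
  have hY : ∀ s, 0 < s → IsHalfLineIntegral B P (cutKernel lam s) (Y s) := by
    intro s hs
    refine (IsHalfLineIntegral.sum hB' Finset.univ fun j _ =>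
      (hV.isHalfLineIntegral_powerIntegral hB' (s := s) (hlam j)).const_mul
        (s⁻¹ * muntzCoeff lam j * s ^ (-lam j))).congr (fun x hx => ?_) (ae_eq_refl _)
    by_cases hxs : x ≤ s
    · rw [cutKernel_of_mem lam ⟨hx, hxs⟩, muntzK, Finset.mul_sum]
      refine Finset.sum_congr rfl fun j _ => ?_
      rw [indicator_of_mem (mem_Iic.2 hxs), Real.div_rpow hx.le hs.le, Real.rpow_neg hs.le]
      ring
    · rw [cutKernel, indicator_of_notMem fun h => hxs h.2]
      exact Finset.sum_eq_zero fun j _ => by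
        rw [indicator_of_notMem (notMem_Iic.2 (not_le.1 hxs)), mul_zero]
  -- Integer horizons suffice and leave a single null set valid for all `t`. On the probability
  -- space, pairing with the constant `1` turns the norm bound into joint integrability.
  have hint : ∀ N : ℕ, ∀ᵐ ω ∂P, IntegrableOn (fun s => Y s ω) (Ioc 0 (N : ℝ)) := by
    intro N
    have hfin : ∫⁻ s in Ioc 0 (N : ℝ), eLpNorm (Y s) 2 P ≠ ∞ := by
      refine ne_of_eq_of_ne (setLIntegral_congr_fun measurableSet_Ioc fun s hs => ?_)
        (lintegral_eLpNorm_cutKernel_lt_top lam (fun s hs => (hY s hs).memLp) N).ne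
      exact (hY s hs.1).eLpNorm_eq hB'
    have := integrable_uncurry_mul hYm.aestronglyMeasurable hfin (memLp_const (1 : ℝ))
    simpa [IntegrableOn, Function.uncurry] using this.prod_left_ae
  refine ⟨fun t ω => B t ω - ∫ s in Ioc 0 (t : ℝ), Y s ω, Y, hYm.aestronglyMeasurable,
    fun s hs => (hY s hs).isWienerIntegralOn Ioc_subset_Ioi_self, ?_⟩
  filter_upwards [ae_all_iff.2 hint] with ω hω t
  obtain ⟨N, hN⟩ := exists_nat_ge (t : ℝ)
  exact ⟨(hω N).mono_set (Ioc_subset_Ioc_right hN), rfl⟩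

end Existence

/-! ### The kernel of the moving average -/

section Eta

variable {n : ℕ} {lam : Fin n → ℝ}

lemma muntzK_exp_neg (y : ℝ) :
    muntzK lam (Real.exp (-y)) = ∑ j, muntzCoeff lam j * Real.exp (-(lam j * y)) := by
  refine Finset.sum_congr rfl fun j _ => ?_
  rw [← Real.exp_mul]
  congr 2
  ring

lemma continuous_muntzK_exp_neg : Continuous fun y => muntzK lam (Real.exp (-y)) := by
  simp only [muntzK_exp_neg]
  fun_prop

/-- With `r = e^y` the measure `dr/r` becomes `dy`, and `K_n` a sum of exponentials. -/
lemma muntzRho_exp (t : ℝ) :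
    muntzRho lam (Real.exp t) = 1 - ∫ y in (0 : ℝ)..t, muntzK lam (Real.exp (-y)) := by
  have h := intervalIntegral.integral_comp_mul_deriv' (a := 0) (b := t) (f := Real.exp)
    (f' := Real.exp) (g := fun r => muntzK lam (1 / r) / r) (fun x _ => Real.hasDerivAt_exp x)
    Real.continuous_exp.continuousOn ?_
  · rw [Real.exp_zero] at h
    rw [muntzRho, ← h]
    congr 2
    ext y
    have := (Real.exp_pos y).ne'
    simp only [Function.comp_apply]
    rw [Real.exp_neg, one_div]
    field_simp
  · rintro _ ⟨x, _, rfl⟩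
    have hx := (Real.exp_pos x).ne'
    refine ContinuousAt.continuousWithinAt (ContinuousAt.div ?_ continuousAt_id hx)
    unfold muntzK
    refine tendsto_finsetSum _ fun j _ => ContinuousAt.const_mul ?_ _
    refine ContinuousAt.rpow_const (continuousAt_const.div continuousAt_id hx) (Or.inl ?_)
    exact one_div_ne_zero hx

lemma hasDerivAt_muntzRho_exp (t : ℝ) :
    HasDerivAt (fun t => muntzRho lam (Real.exp t)) (-muntzK lam (Real.exp (-t))) t := by
  simp only [muntzRho_exp]
  have h := (continuous_muntzK_exp_neg (lam := lam))
  exact (intervalIntegral.integral_hasDerivAt_right (h.intervalIntegrable _ _)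
    h.aestronglyMeasurable.stronglyMeasurableAtFilter h.continuousAt).const_sub 1

lemma continuous_muntzRho_exp : Continuous fun t => muntzRho lam (Real.exp t) :=
  continuous_iff_continuousAt.2 fun t => (hasDerivAt_muntzRho_exp t).continuousAt

lemma muntzEta_eq_indicator :
    muntzEta lam = (Ioi 0).indicator fun t => Real.exp (-t / 2) * muntzRho lam (Real.exp t) := by
  ext t
  simp [muntzEta, indicator_apply]

lemma measurable_muntzEta : Measurable (muntzEta lam) := by
  rw [muntzEta_eq_indicator]
  have := continuous_muntzRho_exp (lam := lam)
  exact (Continuous.measurable (by fun_prop)).indicator measurableSet_Ioi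

lemma exists_lower_bound (hlam : ∀ j, -1 / 2 < lam j) :
    ∃ q, 0 < q ∧ q < 1 / 2 ∧ ∀ j, -q ≤ lam j := by
  have h1 : ∀ᶠ q in 𝓝[<] (1 / 2 : ℝ), ∀ j, -q < lam j := by
    refine eventually_all.2 fun j => ?_
    have : Tendsto (fun q : ℝ => -q) (𝓝[<] (1 / 2 : ℝ)) (𝓝 (-(1 / 2))) :=
      (continuous_neg.tendsto _).mono_left nhdsWithin_le_nhds
    exact this.eventually_lt_const (by linarith [hlam j])
  have h2 : ∀ᶠ q in 𝓝[<] (1 / 2 : ℝ), 0 < q :=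
    nhdsWithin_le_nhds (lt_mem_nhds (by norm_num))
  obtain ⟨q, ⟨hq1, hq2⟩, hq3⟩ := ((h1.and h2).and self_mem_nhdsWithin).exists
  exact ⟨q, hq2, hq3, fun j => (hq1 j).le⟩

/-- The kernel decays exponentially. -/
lemma exists_bound_muntzRho (hlam : ∀ j, -1 / 2 < lam j) :
    ∃ C δ : ℝ, 0 < δ ∧ ∀ t, 0 ≤ t →
      |Real.exp (-t / 2) * muntzRho lam (Real.exp t)| ≤ C * Real.exp (-δ * t) := by
  obtain ⟨q, hq0, hq1, hq⟩ := exists_lower_bound hlam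
  set A : ℝ := ∑ j, |muntzCoeff lam j| with hA
  have hA0 : 0 ≤ A := Finset.sum_nonneg fun _ _ => abs_nonneg _
  -- Half of the gap `1/2 - q`: one half absorbs the linear factor through `t ≤ e^{δt}/δ`, the other
  -- remains as the decay rate.
  set δ : ℝ := (1 / 2 - q) / 2 with hδ
  have hδ0 : 0 < δ := by rw [hδ]; linarith
  refine ⟨1 + A / δ, δ, hδ0, fun t ht => ?_⟩
  have hK : ∀ y ∈ uIoc 0 t, ‖muntzK lam (Real.exp (-y))‖ ≤ A * Real.exp (q * t) := by
    intro y hy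
    rw [uIoc_of_le ht] at hy
    rw [muntzK_exp_neg, hA, Finset.sum_mul]
    refine (norm_sum_le _ _).trans (Finset.sum_le_sum fun j _ => ?_)
    rw [norm_mul, Real.norm_eq_abs, Real.norm_eq_abs, Real.abs_exp]
    gcongr
    nlinarith [hq j, hy.1, hy.2]
  have hI := intervalIntegral.norm_integral_le_of_norm_le_const hK
  rw [sub_zero, abs_of_nonneg ht, Real.norm_eq_abs] at hI
  have hρ : |muntzRho lam (Real.exp t)| ≤ 1 + A * Real.exp (q * t) * t := by
    rw [muntzRho_exp]
    exact (abs_sub _ _).trans (by simpa using hI)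
  have h1 : 1 ≤ Real.exp (δ * t) := Real.one_le_exp (by positivity)
  have h1' : 1 ≤ Real.exp (q * t) := Real.one_le_exp (by positivity)
  have h2 : t ≤ Real.exp (δ * t) / δ := by
    rw [le_div_iff₀ hδ0]
    linarith [Real.add_one_le_exp (δ * t)]
  have h3 : Real.exp (-δ * t) = Real.exp (-t / 2) * (Real.exp (q * t) * Real.exp (δ * t)) := by
    rw [← Real.exp_add, ← Real.exp_add]
    congr 1
    rw [hδ]
    ring
  rw [abs_mul, Real.abs_exp, h3]
  calc Real.exp (-t / 2) * |muntzRho lam (Real.exp t)|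
      ≤ Real.exp (-t / 2) * (1 + A * Real.exp (q * t) * t) := by gcongr
    _ ≤ Real.exp (-t / 2) * (Real.exp (q * t) * Real.exp (δ * t) +
          A * Real.exp (q * t) * (Real.exp (δ * t) / δ)) := by
        gcongr
        exact one_le_mul_of_one_le_of_one_le h1' h1
    _ = _ := by ring

lemma exists_bound_muntzEta (hlam : ∀ j, -1 / 2 < lam j) :
    ∃ C δ : ℝ, 0 < δ ∧ ∀ t, |muntzEta lam t| ≤
      (Ioi 0).indicator (fun t => C * Real.exp (-δ * t)) t := by
  obtain ⟨C, δ, hδ, h⟩ := exists_bound_muntzRho hlam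
  refine ⟨C, δ, hδ, fun t => ?_⟩
  rw [muntzEta_eq_indicator]
  by_cases ht : t ∈ Ioi (0 : ℝ)
  · rw [indicator_of_mem ht, indicator_of_mem ht]
    exact h t (le_of_lt ht)
  · rw [indicator_of_notMem ht, indicator_of_notMem ht, abs_zero]

lemma integrable_muntzEta (hlam : ∀ j, -1 / 2 < lam j) : Integrable (muntzEta lam) := by
  obtain ⟨C, δ, hδ, h⟩ := exists_bound_muntzEta hlam
  refine Integrable.mono' (((integrable_indicator_iff measurableSet_Ioi).2
    ((exp_neg_integrableOn_Ioi 0 hδ).const_mul C))) measurable_muntzEta.aestronglyMeasurable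
    (Eventually.of_forall h)

lemma memLp_two_muntzEta (hlam : ∀ j, -1 / 2 < lam j) : MemLp (muntzEta lam) 2 := by
  obtain ⟨C, δ, hδ, h⟩ := exists_bound_muntzEta hlam
  refine (memLp_two_iff_integrable_sq measurable_muntzEta.aestronglyMeasurable).2 ?_
  refine Integrable.mono' (((integrable_indicator_iff measurableSet_Ioi).2
    ((exp_neg_integrableOn_Ioi 0 (b := 2 * δ) (by positivity)).const_mul (C ^ 2))))
    (measurable_muntzEta.pow_const 2).aestronglyMeasurable (Eventually.of_forall fun t => ?_)
  rw [Real.norm_eq_abs, abs_pow]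
  refine (pow_le_pow_left₀ (abs_nonneg _) (h t) 2).trans (le_of_eq ?_)
  by_cases ht : t ∈ Ioi (0 : ℝ)
  · rw [indicator_of_mem ht, indicator_of_mem ht, mul_pow, ← Real.exp_nat_mul]
    congr 2
    push_cast
    ring
  · rw [indicator_of_notMem ht, indicator_of_notMem ht, zero_pow two_ne_zero]

/-- Partial fraction decomposition of a product of Möbius transformations. -/
lemma one_add_sum_eq_prod {ι : Type*} [DecidableEq ι] (s : Finset ι) (p : ι → ℂ)
    (hp : Set.InjOn p s) {z : ℂ} (hz : ∀ i ∈ s, z ≠ p i) :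
    1 + ∑ j ∈ s, (∏ l ∈ s, (p j + p l)) / (∏ l ∈ s.erase j, (p j - p l)) * (z - p j)⁻¹ =
      ∏ l ∈ s, (z + p l) / (z - p l) := by
  -- Both polynomials are monic of degree `s.card`, so the difference has lower degree and equals
  -- its Lagrange interpolant at the `p j`; the nodal polynomial vanishes there, leaving the values
  -- `∏ (p j + p l)`.
  have hdeg : (∏ l ∈ s, (Polynomial.X + Polynomial.C (p l)) -
      Lagrange.nodal s p).degree < s.card := by
    have hm : (∏ l ∈ s, (Polynomial.X + Polynomial.C (p l))).Monic :=
      Polynomial.monic_prod_of_monic _ _ fun l _ => Polynomial.monic_X_add_C _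
    have hd : (∏ l ∈ s, (Polynomial.X + Polynomial.C (p l))).degree = (s.card : WithBot ℕ) := by
      simp [Polynomial.degree_prod]
    rw [← hd]
    exact Polynomial.degree_sub_lt_left (by rw [hd, Lagrange.degree_nodal]) hm.ne_zero
      (by rw [hm.leadingCoeff, Lagrange.nodal_monic.leadingCoeff])
  have h := Lagrange.eq_interpolate_of_eval_eq (fun j => ∏ l ∈ s, (p j + p l)) hp hdeg
    fun i hi => by
      simp [Polynomial.eval_prod, Lagrange.eval_nodal_at_node hi]
  have h2 := congrArg (Polynomial.eval z) h
  rw [Lagrange.eval_interpolate_not_at_node _ hz, Polynomial.eval_sub, Polynomial.eval_prod,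
    Lagrange.eval_nodal] at h2
  simp only [Polynomial.eval_add, Polynomial.eval_X, Polynomial.eval_C] at h2
  have hne : ∏ l ∈ s, (z - p l) ≠ 0 := Finset.prod_ne_zero_iff.2 fun l hl => sub_ne_zero.2 (hz l hl)
  rw [Finset.prod_div_distrib, eq_div_iff hne, add_mul, one_mul]
  rw [sub_eq_iff_eq_add] at h2
  rw [h2, add_comm, mul_comm (∏ l ∈ s, (z - p l))]
  congr 2
  refine Finset.sum_congr rfl fun j _ => ?_
  rw [Lagrange.nodalWeight, Finset.prod_inv_distrib]
  ring

lemma integral_exp_mul_muntzEta (hinj : Function.Injective lam) (hlam : ∀ j, -1 / 2 < lam j)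
    (ξ : ℝ) :
    ∫ x : ℝ, Complex.exp (Complex.I * ξ * x) * (muntzEta lam x : ℂ) =
      (1 / 2 - Complex.I * ξ)⁻¹ *
        ∏ j, ((ξ : ℂ) - Complex.I * ((1 / 2 + lam j : ℝ) : ℂ)) /
          ((ξ : ℂ) + Complex.I * ((1 / 2 + lam j : ℝ) : ℂ)) := by
  set p : Fin n → ℂ := fun j => ((1 / 2 + lam j : ℝ) : ℂ) with hp
  set z : ℂ := Complex.I * ξ with hz
  have hzre : z.re = 0 := by simp [hz]
  have hpre : ∀ j, 0 < (p j).re := fun j => by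
    simp only [hp, Complex.ofReal_re]
    linarith [hlam j]
  have hzp : ∀ j, z ≠ p j := fun j h => by
    have := hpre j
    rw [← h, hzre] at this
    exact lt_irrefl _ this
  -- `G` and `H` drop the cutoff in `muntzEta`, so that `H` is differentiable at `0` with boundary
  -- value `1`.
  set G : ℝ → ℂ := fun t => ((Real.exp (-t / 2) * muntzRho lam (Real.exp t) : ℝ) : ℂ) with hG
  set H : ℝ → ℂ := fun t => Complex.exp (z * t) * G t with hH
  have hHη : ∀ x : ℝ, Complex.exp (z * x) * (muntzEta lam x : ℂ) = (Ioi 0).indicator H x := by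
    intro x
    rw [muntzEta_eq_indicator]
    by_cases hx : x ∈ Ioi (0 : ℝ) <;> simp [hx, hH, hG]
  have hnorm : ∀ x : ℝ, ‖Complex.exp (z * x)‖ = 1 := fun x => by
    rw [Complex.norm_exp]
    simp [hz]
  have hcexp : Continuous fun x : ℝ => Complex.exp (z * x) := by fun_prop
  have hHint : IntegrableOn H (Ioi 0) := by
    rw [← integrable_indicator_iff measurableSet_Ioi]
    refine Integrable.congr ?_ (Eventually.of_forall hHη)
    exact (integrable_muntzEta hlam).ofReal.bdd_mul hcexp.aestronglyMeasurable
      (Eventually.of_forall fun x => (hnorm x).le)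
  have hE : ∀ j, IntegrableOn (fun t : ℝ => (muntzCoeff lam j : ℂ) *
      Complex.exp ((z - p j) * t)) (Ioi 0) := fun j =>
    (integrableOn_exp_mul_complex_Ioi (by simpa [hzre] using hpre j) 0).const_mul _
  -- The factor `e^{-t/2}` shifts each exponent `lam j` of `K_n(e^{-t})` to `p j`.
  have hderiv : ∀ t ∈ Ici (0 : ℝ), HasDerivAt H ((z - 1 / 2) * H t -
      ∑ j, (muntzCoeff lam j : ℂ) * Complex.exp ((z - p j) * t)) t := by
    intro t _
    have h1 : HasDerivAt (fun t : ℝ => Complex.exp (z * t)) (Complex.exp (z * t) * (z * 1)) t :=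
      ((Complex.ofRealCLM.hasDerivAt (x := t)).const_mul z).cexp
    have h2 : HasDerivAt (fun t : ℝ => Real.exp (-t / 2)) (Real.exp (-t / 2) * (-1 / 2)) t :=
      ((hasDerivAt_id t).neg.div_const 2).exp
    have h3 := (h2.mul (hasDerivAt_muntzRho_exp (lam := lam) t)).ofReal_comp
    refine (h1.mul h3).congr_deriv ?_
    have h4 : ∑ j, (muntzCoeff lam j : ℂ) * Complex.exp ((z - p j) * t) =
        Complex.exp (z * t) * (Complex.exp (-t / 2) * (muntzK lam (Real.exp (-t)) : ℂ)) := by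
      rw [muntzK_exp_neg, Complex.ofReal_sum, Finset.mul_sum, Finset.mul_sum]
      refine Finset.sum_congr rfl fun j _ => ?_
      push_cast
      rw [mul_left_comm _ (muntzCoeff lam j : ℂ), mul_left_comm _ (muntzCoeff lam j : ℂ),
        ← Complex.exp_add, ← Complex.exp_add]
      congr 2
      simp only [hp]
      push_cast
      ring
    rw [h4, hH, hG]
    simp only [Pi.mul_apply]
    push_cast
    ring
  have hlim : Tendsto H atTop (𝓝 0) := by
    obtain ⟨C, δ, hδ, hb⟩ := exists_bound_muntzRho hlam
    refine squeeze_zero_norm' (a := fun t => C * Real.exp (-δ * t)) ?_ ?_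
    · filter_upwards [eventually_ge_atTop 0] with t ht
      rw [hH, norm_mul, hnorm, one_mul, hG, Complex.norm_real]
      exact hb t ht
    · have : Tendsto (fun t : ℝ => Real.exp (-δ * t)) atTop (𝓝 0) :=
        Real.tendsto_exp_atBot.comp (tendsto_id.const_mul_atTop_of_neg (neg_lt_zero.2 hδ))
      simpa using this.const_mul C
  have hS : IntegrableOn (fun t : ℝ => ∑ j, (muntzCoeff lam j : ℂ) *
      Complex.exp ((z - p j) * t)) (Ioi 0) := integrable_finsetSum _ fun j _ => hE j
  have hFTC := integral_Ioi_of_hasDerivAt_of_tendsto' hderiv ((hHint.const_mul _).sub hS) hlim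
  have hH0 : H 0 = 1 := by simp [hH, hG, muntzRho]
  rw [integral_sub (hHint.const_mul _) hS, integral_const_mul,
    integral_finsetSum _ fun j _ => hE j, hH0] at hFTC
  have hterm : ∀ j, ∫ t in Ioi (0 : ℝ), (muntzCoeff lam j : ℂ) * Complex.exp ((z - p j) * t) =
      -((∏ l, (p j + p l)) / (∏ l ∈ Finset.univ.erase j, (p j - p l)) * (z - p j)⁻¹) := by
    intro j
    rw [integral_const_mul, integral_exp_mul_complex_Ioi (by simpa [hzre] using hpre j)]
    have hcoeff : (muntzCoeff lam j : ℂ) =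
        (∏ l, (p j + p l)) / (∏ l ∈ Finset.univ.erase j, (p j - p l)) := by
      rw [muntzCoeff]
      push_cast
      simp only [hp]
      congr 1 <;> refine Finset.prod_congr rfl fun l _ => ?_ <;> push_cast <;> ring
    rw [hcoeff]
    simp [div_eq_mul_inv]
  simp_rw [hterm] at hFTC
  have hpinj : Set.InjOn p (Finset.univ : Finset (Fin n)) := fun i _ j _ h => by
    simp only [hp, Complex.ofReal_inj] at h
    exact hinj (by linarith)
  have hpf := one_add_sum_eq_prod Finset.univ p hpinj fun j _ => hzp j
  have hprod : ∏ j, ((ξ : ℂ) - Complex.I * p j) / ((ξ : ℂ) + Complex.I * p j) =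
      ∏ l, (z + p l) / (z - p l) := by
    refine Finset.prod_congr rfl fun j _ => ?_
    -- Multiply numerator and denominator by `-i`: `-i(iξ ± p) = ξ ∓ ip`.
    rw [← mul_div_mul_left (z + p j) (z - p j) (neg_ne_zero.2 Complex.I_ne_zero), hz]
    congr 1 <;> ring_nf <;> simp [Complex.I_sq]
  simp_rw [hHη]
  rw [integral_indicator measurableSet_Ioi, hprod, ← hpf]
  have hhalf : (1 / 2 - z : ℂ) ≠ 0 := fun h => by
    have := congrArg Complex.re h
    rw [Complex.sub_re, hzre] at this
    norm_num at this
  rw [eq_inv_mul_iff_mul_eq₀ hhalf]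
  rw [Finset.sum_neg_distrib] at hFTC
  linear_combination -hFTC

end Eta

end MuntzTransform

end

/-! ### The theorem -/

theorem proposition3p1 {Ω : Type*} [MeasurableSpace Ω] (P : Measure Ω) [IsProbabilityMeasure P]
    (B : ℝ≥0 → Ω → ℝ) (hB : IsBrownianReal B P)
    (n : ℕ) (lam : Fin n → ℝ) (hinj : Function.Injective lam) (hlam : ∀ j, -1 / 2 < lam j) :
    -- the transform and the driving process exist
    (∃ X : ℝ≥0 → Ω → ℝ,
      MuntzTransform.IsVolterraTransform (MuntzTransform.muntzKernel lam) B X P) ∧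
    (∃ W : ℝ → Ω → ℝ, MuntzTransform.IsLogTimeChange B W P) ∧
    -- the moving-average representation
    (∀ (X : ℝ≥0 → Ω → ℝ) (W : ℝ → Ω → ℝ),
      MuntzTransform.IsVolterraTransform (MuntzTransform.muntzKernel lam) B X P →
      MuntzTransform.IsLogTimeChange B W P →
      MuntzTransform.IsBrownianOnLine W P ∧
      ∀ u : ℝ, MuntzTransform.IsWienerIntegralOn W P (Iic u)
        (fun v => MuntzTransform.muntzEta lam (u - v)) (MuntzTransform.timeChange X u)) ∧
    -- the Fourier transform of its kernel
    Integrable (MuntzTransform.muntzEta lam) ∧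
    MemLp (MuntzTransform.muntzEta lam) 2 ∧
    ∀ ξ : ℝ,
      ∫ x : ℝ, Complex.exp (Complex.I * ξ * x) * (MuntzTransform.muntzEta lam x : ℂ) =
        (1 / 2 - Complex.I * ξ)⁻¹ *
          ∏ j, ((ξ : ℂ) - Complex.I * ((1 / 2 + lam j : ℝ) : ℂ)) /
            ((ξ : ℂ) + Complex.I * ((1 / 2 + lam j : ℝ) : ℂ)) := by
  have hB' := hB.toIsPreBrownianReal
  have hη := MuntzTransform.memLp_two_muntzEta hlam
  exact ⟨MuntzTransform.exists_isVolterraTransform hB hlam,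
    MuntzTransform.exists_isLogTimeChange hB,
    fun X W hX hW => ⟨hW.isBrownianOnLine hB',
      hX.isWienerIntegralOn_timeChange hB' hW hη⟩,
    MuntzTransform.integrable_muntzEta hlam, hη,
    MuntzTransform.integral_exp_mul_muntzEta hinj hlam⟩
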